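/- For $q\in(1,2]$ and a sequence $(d_i)_{i\ge1}\in\{0,1\}^{\mathbb N}$ write $(d_i)_q:=\sum_{i\ge1}d_iq^{-i}$; the sequence is a $q$-expansion of $x$ if $(d_i)_q=x$. For $x>0$ let $\mathscr U(x)$ be the set of all $q\in(1,2]$ for which $x$ has exactly one $q$-expansion, and let $q_s(x):=\inf\mathscr U(x)$. Let $q_G=(1+\sqrt5)/2$ be the golden ratio. For finite words $u,v$ of $0$'s and $1$'s, $uv^\infty$ denotes the sequence $uvvv\cdots$. **Theorem.** For every $x>0$ the set $\mathscr U(x)$ is non-empty. The function $q_s:(0,\infty)\to\mathbb R$ has a maximum value $q_{\max}$, which is attained at $x=1/q_G=(\sqrt5-1)/2$ and at no other $x>0$, and $$q_{\max}=q_s(1/q_G)=r\approx 1.888453328\qquad(|r-1.888453328|<5\cdot10^{-10}),$$ where $r$ is the unique base in $(1,2]$ such that $$\big(1(0010001100011)^\infty\big)_r=\big(100(1000110001100)^\infty\big)_r=\frac1{q_G}$$ (each of these two equations has $r$ as its only solution in $(1,2]$). The number $r$ is an algebraic integer of degree $26$: it is a zero of the polynomial $$t^{26}-t^{25}-t^{24}-t^{22}-2t^{21}-2t^{18}-3t^{17}-2t^{16}-2t^{14}-5t^{13}-t^{12}-t^{10}-3t^9-t^8-t^5-t^4+1,$$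 which is irreducible and is the minimal polynomial of $r$ over $\mathbb Q$. -/

import Mathlib

namespace SmallestUnivoqueBase

/-- An infinite sequence of binary digits. The digit usually called `d_i`, `i ≥ 1`, is `d (i - 1)`
here, since the indexing starts at `0`. -/
abbrev DigitSeq : Type := ℕ → Fin 2

/-- The value `(d_i)_q = ∑_{i ≥ 1} d_i / q ^ i` (the series converges for every `q > 1`). -/
noncomputable def value (q : ℝ) (d : DigitSeq) : ℝ :=
  ∑' i : ℕ, (((d i : Fin 2) : ℕ) : ℝ) / q ^ (i + 1)

/-- The sequence `d` is a `q`-expansion of `x`. -/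
def IsExpansion (q : ℝ) (d : DigitSeq) (x : ℝ) : Prop :=
  value q d = x

/-- The set `𝒰(x)` of all bases `q ∈ (1, 2]` in which `x` has a unique expansion with digits
`0` and `1`. -/
def univoqueBases (x : ℝ) : Set ℝ :=
  {q : ℝ | q ∈ Set.Ioc (1 : ℝ) 2 ∧ ∃! d : DigitSeq, IsExpansion q d x}

/-- The function `q_s(x) = inf 𝒰(x)`, of interest for `x > 0`. -/
noncomputable def qs (x : ℝ) : ℝ :=
  sInf (univoqueBases x)

/-- The eventually periodic sequence `u v^∞ = u v v v ⋯` (for a non-empty word `v`). -/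
def eventuallyPeriodic (u v : List (Fin 2)) : DigitSeq := fun n =>
  if n < u.length then u.getD n 0 else v.getD ((n - u.length) % v.length) 0

open Polynomial in
/-- The polynomial `t^26 - t^25 - t^24 - t^22 - 2 t^21 - ⋯ - t^5 - t^4 + 1`. -/
noncomputable def maxPoly : ℤ[X] :=
  X ^ 26 - X ^ 25 - X ^ 24 - X ^ 22 - 2 * X ^ 21 - 2 * X ^ 18 - 3 * X ^ 17 - 2 * X ^ 16
    - 2 * X ^ 14 - 5 * X ^ 13 - X ^ 12 - X ^ 10 - 3 * X ^ 9 - X ^ 8 - X ^ 5 - X ^ 4 + 1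

end SmallestUnivoqueBase

namespace SmallestUnivoqueBase

/-! Write g = 1/q_G, so that g^2 + g = 1.

Upper bounds rest on `UnivoqueIn`, a sufficient condition for uniqueness that survives enlarging the
base. If d satisfies it in base q₀ ≤ r and (d)_r < x ≤ (d)_{q₀}, continuity yields a base in [q₀, r)
where d is the unique expansion of x (`UnivoqueIn.exists_base_lt`). It remains to cover every x ≠ g.
Below g the sequences 0^k(01)^∞ almost suffice; the largest x use 1^∞; a finite list of eventually
periodic sequences fills most of the rest. The values just above g are reached by 1 w^m 0010(0011)^∞
with w = 0010001100011, which converges to the critical sequence 1w^∞ as m grows. Numerical facts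
are certified by integer inequalities on finite graphs.

At x = g, the critical sequence is univoque in base r, so r is an admissible base. For q < r, the
tails of a unique expansion must avoid the switch region [1/q, 1/(q(q-1))], where either digit can
be chosen; this makes the orbit of g deterministic. The relation g^2 + g = 1 pushes the fourth tail
past the lower end of that region, and avoiding the region then forces q very close to r. From there
the orbit starts slightly below the fixed point of w and avoidance makes it repeat w forever, while
its distance to the fixed point is multiplied by q^13 in each period: a contradiction
(`AvoidsSwitch.false_of_near_period`).

Irreducibility holds because the polynomial takes a prime value at 5 while all its roots have
modulus below 2, so a nonconstant monic factor has absolute value at least 3 at 5. -/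

/-! ### Digit sequences and their values -/

/-- The tail of a digit sequence starting at position `n`. -/
def shift (n : ℕ) (d : DigitSeq) : DigitSeq := fun i => d (n + i)

/-- The digitwise complement `0 ↔ 1`. -/
def compl (d : DigitSeq) : DigitSeq := fun i => 1 - d i

/-- The sequence `a d_1 d_2 ⋯`. -/
def consSeq (a : Fin 2) (d : DigitSeq) : DigitSeq
  | 0 => a
  | n + 1 => d n

/-- The first `n` digits of `d` followed by the sequence `e`. -/
def splice (n : ℕ) (d e : DigitSeq) : DigitSeq := fun i => if i < n then d i else e (i - n)

theorem digit_nonneg (a : Fin 2) : (0 : ℝ) ≤ ((a : ℕ) : ℝ) := Nat.cast_nonneg _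

theorem digit_le_one (a : Fin 2) : ((a : ℕ) : ℝ) ≤ 1 := by
  exact_mod_cast Nat.le_of_lt_succ a.isLt

theorem digit_cases (a : Fin 2) : a = 0 ∨ a = 1 := by
  fin_cases a <;> simp

theorem hasSum_ones {q : ℝ} (hq : 1 < q) :
    HasSum (fun i : ℕ => 1 / q ^ (i + 1)) (1 / (q - 1)) := by
  have h := (hasSum_geometric_of_lt_one (r := q⁻¹) (by positivity)
    (inv_lt_one_of_one_lt₀ hq)).mul_left q⁻¹
  have e : q⁻¹ * (1 - q⁻¹)⁻¹ = 1 / (q - 1) := by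
    have : q ≠ 0 := by positivity
    have : q - 1 ≠ 0 := by linarith
    field_simp
  rw [e] at h
  refine h.congr_fun ?_
  intro i
  simp [pow_succ, mul_comm]

theorem term_nonneg {q : ℝ} (hq : 0 < q) (d : DigitSeq) (i : ℕ) :
    0 ≤ (((d i : Fin 2) : ℕ) : ℝ) / q ^ (i + 1) := by positivity

theorem term_le {q : ℝ} (hq : 0 < q) (d : DigitSeq) (i : ℕ) :
    (((d i : Fin 2) : ℕ) : ℝ) / q ^ (i + 1) ≤ 1 / q ^ (i + 1) := by
  gcongr
  exact digit_le_one _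

theorem summable_terms {q : ℝ} (hq : 1 < q) (d : DigitSeq) :
    Summable fun i : ℕ => (((d i : Fin 2) : ℕ) : ℝ) / q ^ (i + 1) :=
  (hasSum_ones hq).summable.of_nonneg_of_le (term_nonneg (by linarith) d)
    (term_le (by linarith) d)

theorem value_nonneg {q : ℝ} (hq : 0 < q) (d : DigitSeq) : 0 ≤ value q d :=
  tsum_nonneg (term_nonneg hq d)

theorem value_le {q : ℝ} (hq : 1 < q) (d : DigitSeq) : value q d ≤ 1 / (q - 1) := by
  rw [← (hasSum_ones hq).tsum_eq]
  exact (summable_terms hq d).tsum_le_tsum (term_le (by linarith) d) (hasSum_ones hq).summable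

theorem mul_value {q : ℝ} (hq : 1 < q) (d : DigitSeq) :
    q * value q d = ((d 0 : ℕ) : ℝ) + value q (shift 1 d) := by
  have hq0 : q ≠ 0 := by positivity
  unfold value
  rw [(summable_terms hq d).tsum_eq_zero_add, mul_add, ← tsum_mul_left]
  congr 1
  · simp; field_simp
  · refine tsum_congr fun i => ?_
    rw [show shift 1 d i = d (i + 1) by simp [shift, add_comm], pow_succ q (i + 1)]
    field_simp

theorem shift_shift (m n : ℕ) (d : DigitSeq) : shift m (shift n d) = shift (n + m) d := by
  funext i; simp [shift, add_assoc]

theorem shift_zero (d : DigitSeq) : shift 0 d = d := by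
  funext i; simp [shift]

theorem mul_value_shift {q : ℝ} (hq : 1 < q) (d : DigitSeq) (n : ℕ) :
    q * value q (shift n d) = ((d n : ℕ) : ℝ) + value q (shift (n + 1) d) := by
  rw [mul_value hq, shift_shift]; rfl

theorem value_antitone {p q : ℝ} (hp : 1 < p) (hpq : p ≤ q) (d : DigitSeq) :
    value q d ≤ value p d := by
  refine (summable_terms (hp.trans_le hpq) d).tsum_le_tsum (fun i => ?_) (summable_terms hp d)
  gcongr

theorem value_strictAnti {p q : ℝ} (hp : 1 < p) (hpq : p < q) {d : DigitSeq} {n : ℕ}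
    (hn : d n = 1) : value q d < value p d := by
  refine Summable.tsum_lt_tsum (i := n) (fun i => ?_) ?_
    (summable_terms (hp.trans hpq) d) (summable_terms hp d)
  · gcongr
  · rw [hn]
    have : p ^ (n + 1) < q ^ (n + 1) := by gcongr
    have : (0:ℝ) < p ^ (n + 1) := by positivity
    simp only [Fin.val_one, Nat.cast_one]
    gcongr

theorem continuousOn_value (d : DigitSeq) : ContinuousOn (fun q => value q d) (Set.Ioi 1) := by
  intro q hq
  have hq1 : (1 : ℝ) < q := hq
  obtain ⟨a, ha, haq⟩ := exists_between hq1
  have : ContinuousOn (fun q => value q d) (Set.Ici a) := by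
    refine continuousOn_tsum (u := fun i : ℕ => 1 / a ^ (i + 1)) (fun i => ?_)
      (hasSum_ones ha).summable ?_
    · refine ContinuousOn.div continuousOn_const (by fun_prop) fun x hx => ?_
      have : a ≤ x := hx
      have : 0 < x := by linarith
      positivity
    · intro i x hx
      have hx' : a ≤ x := hx
      have h0 : 0 < x := by linarith
      rw [Real.norm_of_nonneg (term_nonneg h0 d i)]
      refine (term_le h0 d i).trans ?_
      gcongr
  exact (this.continuousAt (Ici_mem_nhds haq)).continuousWithinAt

theorem value_add_compl {q : ℝ} (hq : 1 < q) (d : DigitSeq) :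
    value q d + value q (compl d) = 1 / (q - 1) := by
  unfold value
  rw [← (summable_terms hq d).tsum_add (summable_terms hq (compl d)), ← (hasSum_ones hq).tsum_eq]
  refine tsum_congr fun i => ?_
  rw [← add_div]
  congr 1
  rcases digit_cases (d i) with h | h <;> simp [compl, h]

/-- A violation would be multiplied by at least q at every step, whereas the values are bounded
above and `U` is bounded below. -/
theorem value_le_of_recurrence {q : ℝ} (hq : 1 < q) (d : DigitSeq) {U : ℕ → ℝ}
    {B : ℝ} (hB : ∀ n, B ≤ U n)
    (h : ∀ n, ((d n : ℕ) : ℝ) + U (n + 1) ≤ q * U n) (n : ℕ) : value q (shift n d) ≤ U n := by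
  by_contra! hlt
  have key : ∀ k, q ^ k * (value q (shift n d) - U n) ≤
      value q (shift (n + k) d) - U (n + k) := by
    intro k
    induction k with
    | zero => simp
    | succ k ih =>
      have h1 := mul_value_shift hq d (n + k)
      have h2 := h (n + k)
      have h3 := mul_le_mul_of_nonneg_left ih (by linarith : 0 ≤ q)
      rw [← add_assoc, pow_succ]
      linarith
  obtain ⟨k, hk⟩ := pow_unbounded_of_one_lt
    ((1 / (q - 1) - B) / (value q (shift n d) - U n)) hq
  rw [div_lt_iff₀ (by linarith)] at hk
  have := key k
  have := hB (n + k)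
  have := value_le hq (shift (n + k) d)
  linarith

theorem le_value_of_recurrence {q : ℝ} (hq : 1 < q) (d : DigitSeq) {L : ℕ → ℝ}
    {B : ℝ} (hB : ∀ n, L n ≤ B)
    (h : ∀ n, q * L n ≤ ((d n : ℕ) : ℝ) + L (n + 1)) (n : ℕ) : L n ≤ value q (shift n d) := by
  by_contra! hlt
  have key : ∀ k, q ^ k * (L n - value q (shift n d)) ≤
      L (n + k) - value q (shift (n + k) d) := by
    intro k
    induction k with
    | zero => simp
    | succ k ih =>
      have h1 := mul_value_shift hq d (n + k)
      have h2 := h (n + k)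
      have h3 := mul_le_mul_of_nonneg_left ih (by linarith : 0 ≤ q)
      rw [← add_assoc, pow_succ]
      linarith
  obtain ⟨k, hk⟩ := pow_unbounded_of_one_lt (B / (L n - value q (shift n d))) hq
  rw [div_lt_iff₀ (by linarith)] at hk
  have := key k
  have := hB (n + k)
  have := value_nonneg (by linarith) (shift (n + k) d) (q := q)
  linarith

/-- Every point of `[0, 1 / (q - 1)]` has an expansion. -/
theorem exists_expansion {q : ℝ} (hq : 1 < q) (hq2 : q ≤ 2) {y : ℝ} (h0 : 0 ≤ y)
    (h1 : y ≤ 1 / (q - 1)) : ∃ e : DigitSeq, value q e = y := by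
  -- The greedy map: it takes digit 1 whenever possible and keeps [0, 1/(q-1)] invariant because q ≤
  -- 2.
  let T : ℝ → ℝ := fun t => if 1 ≤ q * t then q * t - 1 else q * t
  let t : ℕ → ℝ := fun n => T^[n] y
  have hM : 1 ≤ 1 / (q - 1) := by rw [le_div_iff₀] <;> linarith
  have hMq : q * (1 / (q - 1)) - 1 = 1 / (q - 1) := by
    have : q - 1 ≠ 0 := by linarith
    field_simp; ring
  have ht : ∀ n, 0 ≤ t n ∧ t n ≤ 1 / (q - 1) := by
    intro n
    induction n with
    | zero => exact ⟨h0, h1⟩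
    | succ n ih =>
      simp only [t, Function.iterate_succ_apply']
      change 0 ≤ T (t n) ∧ T (t n) ≤ _
      have a1 := mul_le_mul_of_nonneg_left ih.2 (by linarith : 0 ≤ q)
      have a2 := mul_nonneg (by linarith : 0 ≤ q) ih.1
      simp only [T]
      split_ifs with h <;> constructor <;> linarith
  let e : DigitSeq := fun n => if 1 ≤ q * t n then 1 else 0
  have he : ∀ n, ((e n : ℕ) : ℝ) + t (n + 1) = q * t n := by
    intro n
    simp only [t, Function.iterate_succ_apply']
    change _ + T (t n) = q * t n
    simp only [T, e]
    split_ifs with h <;> simp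
  refine ⟨e, le_antisymm ?_ ?_⟩
  · have h := value_le_of_recurrence hq e (fun n => (ht n).1) (fun n => (he n).le) 0
    rwa [shift_zero] at h
  · have h := le_value_of_recurrence hq e (fun n => (ht n).2) (fun n => (he n).ge) 0
    rwa [shift_zero] at h

theorem value_eq_of_value_shift_eq {q : ℝ} (hq : 1 < q) {d e : DigitSeq} (n : ℕ)
    (hde : ∀ i < n, d i = e i) (h : value q (shift n d) = value q (shift n e)) :
    value q d = value q e := by
  induction n with
  | zero => simpa [shift_zero] using h
  | succ n ih =>
    refine ih (fun i hi => hde i (by omega)) ?_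
    have h1 := mul_value_shift hq d n
    have h2 := mul_value_shift hq e n
    rw [hde n (by omega), h, ← h2] at h1
    exact mul_left_cancel₀ (by linarith : q ≠ 0) h1

theorem value_shift_eq_of_value_eq {q : ℝ} (hq : 1 < q) {d e : DigitSeq} (n : ℕ)
    (hde : ∀ i < n, d i = e i) (h : value q d = value q e) :
    value q (shift n d) = value q (shift n e) := by
  induction n with
  | zero => simpa [shift_zero] using h
  | succ n ih =>
    have h1 := mul_value_shift hq d n
    have h2 := mul_value_shift hq e n
    rw [hde n (by omega), ih fun i hi => hde i (by omega)] at h1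
    linarith

theorem value_consSeq {q : ℝ} (hq : 1 < q) (a : Fin 2) (d : DigitSeq) :
    q * value q (consSeq a d) = ((a : ℕ) : ℝ) + value q d := by
  rw [mul_value hq]
  congr 2
  funext i
  simp [shift, add_comm 1 i, consSeq]

theorem value_splice {q : ℝ} (hq : 1 < q) (n : ℕ) {d e : DigitSeq}
    (h : value q e = value q (shift n d)) : value q (splice n d e) = value q d := by
  refine value_eq_of_value_shift_eq hq n (fun i hi => by simp [splice, hi]) ?_
  rw [← h]
  congr 1
  funext i
  simp [shift, splice]

/-! ### Unique expansions and univoque sequences -/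

/-- A unique expansion never has a tail in the switch region. -/
theorem tail_notMem_of_unique {q : ℝ} (hq : 1 < q) (hq2 : q ≤ 2) {d : DigitSeq}
    (hd : ∀ e, value q e = value q d → e = d) (n : ℕ) (h1 : 1 / q ≤ value q (shift n d)) :
    1 / (q * (q - 1)) < value q (shift n d) := by
  by_contra! h2
  have hq0 : 0 < q := by linarith
  have hq1 : 0 < q - 1 := by linarith
  set t := value q (shift n d)
  have h1' : 1 ≤ q * t := by rw [div_le_iff₀ hq0] at h1; linarith
  have h2' : q * t ≤ 1 / (q - 1) := by
    rw [le_div_iff₀ (by positivity)] at h2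
    rw [le_div_iff₀ hq1]; linarith
  -- In the switch region the remainder after either digit is still representable, so uniqueness
  -- would force the digit `d n` to equal both 0 and 1.
  have h3 : ∀ a : Fin 2, 0 ≤ q * t - ((a : ℕ) : ℝ) → d n = a := by
    intro a ha
    obtain ⟨e, he⟩ := exists_expansion hq hq2 ha
      (by have := digit_nonneg a; linarith)
    have h4 : value q (consSeq a e) = t := by
      have := value_consSeq hq a e
      rw [he] at this
      exact mul_left_cancel₀ hq0.ne' (by linarith)
    have h5 := hd _ (value_splice hq n h4)
    have h6 := congrFun h5 n
    simpa [splice, consSeq] using h6.symm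
  have a := h3 0 (by simp; linarith)
  have b := h3 1 (by simp; linarith)
  rw [a] at b
  exact absurd b (by decide)

/-- The lexicographic characterisation of unique expansions, phrased through values of tails. -/
def UnivoqueIn (q : ℝ) (d : DigitSeq) : Prop :=
  ∀ n, (d n = 0 → value q (shift (n + 1) d) < 1) ∧
    (d n = 1 → value q (compl (shift (n + 1) d)) < 1)

theorem UnivoqueIn.mono {p q : ℝ} {d : DigitSeq} (h : UnivoqueIn p d) (hp : 1 < p) (hpq : p ≤ q) :
    UnivoqueIn q d := fun n =>
  ⟨fun h0 => (value_antitone hp hpq _).trans_lt ((h n).1 h0),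
    fun h1 => (value_antitone hp hpq _).trans_lt ((h n).2 h1)⟩

/-- At the first place where the expansions differ, the tail of `d` after a 0 would have to be at
least 1; the case of a digit 1 is the complement. -/
theorem UnivoqueIn.unique {q : ℝ} (hq : 1 < q) {d e : DigitSeq} (h : UnivoqueIn q d)
    (hde : value q e = value q d) : e = d := by
  by_contra hne
  have hex : ∃ n, e n ≠ d n := by
    by_contra! hall
    exact hne (funext hall)
  classical
  let n := Nat.find hex
  have hn : e n ≠ d n := Nat.find_spec hex
  have hlt : ∀ i < n, e i = d i := fun i hi => by
    simpa using Nat.find_min hex hi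
  have ht := value_shift_eq_of_value_eq hq n hlt hde
  have h1 := mul_value_shift hq d n
  have h2 := mul_value_shift hq e n
  have hc := value_add_compl hq (shift (n + 1) d)
  have hd := h n
  have b1 := value_nonneg (by linarith : 0 < q) (shift (n + 1) e)
  have b2 := value_le hq (shift (n + 1) e)
  rw [ht, h1] at h2
  rcases digit_cases (d n) with hdn | hdn <;> rcases digit_cases (e n) with hen | hen
  · exact hn (hen.trans hdn.symm)
  · have := hd.1 hdn
    simp [hdn, hen] at h2
    linarith
  · have := hd.2 hdn
    simp [hdn, hen] at h2
    linarith
  · exact hn (hen.trans hdn.symm)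

theorem UnivoqueIn.mem_univoqueBases {q x : ℝ} {d : DigitSeq} (h : UnivoqueIn q d) (hq : 1 < q)
    (hq2 : q ≤ 2) (hx : value q d = x) : q ∈ univoqueBases x :=
  ⟨⟨hq, hq2⟩, d, hx, fun _ he => h.unique hq (Eq.trans he hx.symm)⟩

/-- If `d` is univoque in base `q₀` and `x` lies between the values of `d` in the bases `r`
and `q₀`, then `x` has a unique expansion in some base smaller than `r`. -/
theorem UnivoqueIn.exists_base_lt {q₀ r x : ℝ} {d : DigitSeq} (h : UnivoqueIn q₀ d) (hq : 1 < q₀)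
    (hr : q₀ ≤ r) (hr2 : r ≤ 2) (h1 : value r d < x) (h2 : x ≤ value q₀ d) :
    ∃ q ∈ univoqueBases x, q < r := by
  obtain ⟨q, hqm, hqx⟩ := intermediate_value_Icc' hr
    ((continuousOn_value d).mono fun y hy => hq.trans_le hy.1) ⟨h1.le, h2⟩
  have hqx : value q d = x := hqx
  refine ⟨q, (h.mono hq hqm.1).mem_univoqueBases (hq.trans_le hqm.1) (hqm.2.trans hr2) hqx, ?_⟩
  refine lt_of_le_of_ne hqm.2 ?_
  rintro rfl
  exact h1.ne hqx

/-- After a digit 1 the complement of the tail is below 1 exactly when the tail exceeds 1/(q-1) - 1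
= (2-q)/(q-1). -/
theorem univoqueIn_of_bounds {q : ℝ} (hq : 1 < q) {d : DigitSeq} {L U : ℕ → ℝ}
    (hL : ∀ n, L n ≤ value q (shift n d)) (hU : ∀ n, value q (shift n d) ≤ U n)
    (h0 : ∀ n, d n = 0 → U (n + 1) < 1) (h1 : ∀ n, d n = 1 → (2 - q) < L (n + 1) * (q - 1)) :
    UnivoqueIn q d := by
  intro n
  refine ⟨fun h => (hU _).trans_lt (h0 n h), fun h => ?_⟩
  have h2 := value_add_compl hq (shift (n + 1) d)
  have h3 := hL (n + 1)
  have h4 := h1 n h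
  have hq1 : 0 < q - 1 := by linarith
  have : 1 / (q - 1) < 1 + L (n + 1) := by
    rw [div_lt_iff₀ hq1]; linarith
  linarith

/-- Sequences that agree in their first `n` digits have values at most `1 / (q ^ n (q - 1))`
apart. -/
theorem value_le_add_of_agree {q : ℝ} (hq : 1 < q) {d e : DigitSeq} (n : ℕ)
    (hde : ∀ i < n, d i = e i) : value q d ≤ value q e + 1 / (q - 1) / q ^ n := by
  have hq0 : 0 < q := by linarith
  have key : ∀ m ≤ n, value q (shift m d) - value q (shift m e) =
      q ^ m * (value q d - value q e) := by
    intro m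
    induction m with
    | zero => simp [shift_zero]
    | succ m ih =>
      intro hm
      have h1 := mul_value_shift hq d m
      have h2 := mul_value_shift hq e m
      rw [hde m (by omega)] at h1
      rw [pow_succ]
      linear_combination h2 - h1 + q * ih (by omega)
  have h1 := key n le_rfl
  have h2 := value_nonneg hq0 (shift n e)
  have h3 := value_le hq (shift n d)
  have : value q d - value q e ≤ 1 / (q - 1) / q ^ n := by
    rw [le_div_iff₀ (by positivity)]; linarith
  linarith

/-! ### Irreducibility of the polynomial -/

open Polynomial

theorem prime_maxPoly_eval : Nat.Prime 1129140148665621251 := by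
  -- Lucas test with 6 as a primitive root; the factorisation of p - 1 is given in `hf`.
  refine lucas_primality _ (6 : ZMod 1129140148665621251) (by norm_num; reduce_mod_char) ?_
  intro q hq hd
  have hf : (1129140148665621251 - 1 : ℕ) = 2 * 5 ^ 4 * 29 * 691 * 3511 * 12838993 := by norm_num
  have h12 : Nat.Prime 12838993 := by norm_num
  have hq' : q = 2 ∨ q = 5 ∨ q = 29 ∨ q = 691 ∨ q = 3511 ∨ q = 12838993 := by
    rw [hf] at hd
    simp only [hq.dvd_mul] at hd
    have e : ∀ p : ℕ, p.Prime → q ∣ p → q = p := fun p hp h =>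
      (Nat.prime_dvd_prime_iff_eq hq hp).1 h
    rcases hd with ((((hd | hd) | hd) | hd) | hd) | hd
    · exact Or.inl (e 2 (by norm_num) hd)
    · exact Or.inr (Or.inl (e 5 (by norm_num) (hq.dvd_of_dvd_pow hd)))
    · exact Or.inr (Or.inr (Or.inl (e 29 (by norm_num) hd)))
    · exact Or.inr (Or.inr (Or.inr (Or.inl (e 691 (by norm_num) hd))))
    · exact Or.inr (Or.inr (Or.inr (Or.inr (Or.inl (e 3511 (by norm_num) hd)))))
    · exact Or.inr (Or.inr (Or.inr (Or.inr (Or.inr (e _ h12 hd)))))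
  rcases hq' with rfl | rfl | rfl | rfl | rfl | rfl <;> norm_num <;> reduce_mod_char <;> decide

theorem natDegree_maxPoly : maxPoly.natDegree = 26 := by
  unfold maxPoly; compute_degree!

theorem monic_maxPoly : maxPoly.Monic := by
  unfold maxPoly; monicity!

theorem norm_lt_two_of_root {z : ℂ} (hz : aeval z maxPoly = 0) : ‖z‖ < 2 := by
  by_contra! h
  have hz' : z ^ 26 = z ^ 25 + z ^ 24 + z ^ 22 + 2 * z ^ 21 + 2 * z ^ 18 + 3 * z ^ 17 +
      2 * z ^ 16 + 2 * z ^ 14 + 5 * z ^ 13 + z ^ 12 + z ^ 10 + 3 * z ^ 9 + z ^ 8 + z ^ 5 + z ^ 4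
      - 1 := by
    simp only [maxPoly, map_add, map_sub, map_mul, map_pow, aeval_X, map_ofNat, map_one] at hz
    linear_combination hz
  have h1 := congrArg norm hz'
  set t := ‖z‖ with ht
  have h2 : t ^ 26 ≤ t ^ 25 + t ^ 24 + t ^ 22 + 2 * t ^ 21 + 2 * t ^ 18 + 3 * t ^ 17 +
      2 * t ^ 16 + 2 * t ^ 14 + 5 * t ^ 13 + t ^ 12 + t ^ 10 + 3 * t ^ 9 + t ^ 8 + t ^ 5 + t ^ 4
      + 1 := by
    rw [norm_pow] at h1
    rw [← ht] at h1
    rw [h1]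
    refine (norm_sub_le _ _).trans ?_
    rw [norm_one]
    gcongr
    repeat' refine (norm_add_le _ _).trans (add_le_add ?_ ?_)
    all_goals simp [ht]
  -- For t ≥ 2 each power is worth two of the next lower one; chaining down from t^26 outweighs the
  -- whole right side.
  have hs : ∀ n, 2 * t ^ n ≤ t ^ (n + 1) := fun n => by
    rw [pow_succ, mul_comm]; gcongr
  have h4 := hs 4
  have h5 := hs 5
  have h6 := hs 6
  have h7 := hs 7
  have h8 := hs 8
  have h9 := hs 9
  have h10 := hs 10
  have h11 := hs 11
  have h12 := hs 12
  have h13 := hs 13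
  have h14 := hs 14
  have h15 := hs 15
  have h16 := hs 16
  have h17 := hs 17
  have h18 := hs 18
  have h19 := hs 19
  have h20 := hs 20
  have h21 := hs 21
  have h22 := hs 22
  have h23 := hs 23
  have h24 := hs 24
  have h25 := hs 25
  have h3 : 1 ≤ t ^ 4 := one_le_pow₀ (by linarith)
  norm_num at *
  linarith

theorem three_pow_le_norm_prod (s : Multiset ℂ) (hs : ∀ a ∈ s, 3 ≤ ‖5 - a‖) :
    (3 : ℝ) ^ s.card ≤ ‖(s.map fun a => 5 - a).prod‖ := by
  induction s using Multiset.induction_on with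
  | empty => simp
  | cons a s ih =>
    rw [Multiset.map_cons, Multiset.prod_cons, norm_mul, Multiset.card_cons, pow_succ, mul_comm]
    have h1 := hs a (Multiset.mem_cons_self a s)
    have h2 := ih fun b hb => hs b (Multiset.mem_cons_of_mem hb)
    gcongr

theorem natDegree_eq_zero_of_dvd_maxPoly {g : ℤ[X]} (hg : g.Monic) (hd : g ∣ maxPoly)
    (h1 : |g.eval 5| = 1) : g.natDegree = 0 := by
  have hm : (g.map (Int.castRingHom ℂ)).Monic := hg.map _
  have hsp := IsAlgClosed.splits (g.map (Int.castRingHom ℂ))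
  have hroot : ∀ a ∈ (g.map (Int.castRingHom ℂ)).roots, 3 ≤ ‖5 - a‖ := by
    intro a ha
    have ha' : aeval a g = 0 := by
      rw [mem_roots hm.ne_zero, IsRoot.def, eval_map] at ha
      exact ha
    have hlt := norm_lt_two_of_root (z := a) (by
      obtain ⟨k, hk⟩ := hd
      rw [hk, map_mul, ha', zero_mul])
    have := norm_sub_norm_le (5 : ℂ) a
    norm_num at this
    linarith
  have h3 := three_pow_le_norm_prod _ hroot
  have h4 : ((g.map (Int.castRingHom ℂ)).roots.map fun a => 5 - a).prod = ((g.eval 5 : ℤ) : ℂ) := by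
    have h5 := congrArg (eval (5 : ℂ)) (hsp.eq_prod_roots_of_monic hm)
    rw [eval_multiset_prod, Multiset.map_map] at h5
    simp only [Function.comp_def, eval_sub, eval_X, eval_C] at h5
    rw [← h5, eval_map]
    simp
  rw [h4, ← hsp.natDegree_eq_card_roots, hg.natDegree_map] at h3
  have h7 : ‖((g.eval 5 : ℤ) : ℂ)‖ = 1 := by
    rw [Complex.norm_intCast]; exact_mod_cast h1
  rw [h7] at h3
  by_contra hne
  have := one_lt_pow₀ (by norm_num : (1 : ℝ) < 3) hne
  linarith

theorem irreducible_maxPoly : Irreducible maxPoly := by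
  have hne : maxPoly ≠ 1 := fun h => by
    have := natDegree_maxPoly
    rw [h, natDegree_one] at this
    omega
  refine monic_maxPoly.irreducible_iff_natDegree.2 ⟨hne, ?_⟩
  intro f g hf hg hfg
  have h5 : f.eval 5 * g.eval 5 = 1129140148665621251 := by
    rw [← eval_mul, hfg]
    simp [maxPoly]
  have h6 := congrArg Int.natAbs h5
  rw [Int.natAbs_mul] at h6
  have hp := prime_maxPoly_eval
  rw [show (1129140148665621251 : ℕ) = Int.natAbs (1129140148665621251) from rfl, ← h6,
    Nat.prime_mul_iff] at hp
  rcases hp with h | h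
  · right
    refine natDegree_eq_zero_of_dvd_maxPoly hg ⟨f, by rw [← hfg, mul_comm]⟩ ?_
    rw [Int.abs_eq_natAbs, h.2]; rfl
  · left
    refine natDegree_eq_zero_of_dvd_maxPoly hf ⟨g, hfg.symm⟩ ?_
    rw [Int.abs_eq_natAbs, h.2]; rfl

theorem minpoly_eq_of_root {r : ℝ} (hr : aeval r maxPoly = 0) :
    IsIntegral ℤ r ∧ minpoly ℚ r = maxPoly.map (Int.castRingHom ℚ) := by
  refine ⟨⟨maxPoly, monic_maxPoly, hr⟩, ?_⟩
  refine (minpoly.eq_of_irreducible_of_monic ?_ ?_ (monic_maxPoly.map _)).symm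
  · exact (monic_maxPoly.irreducible_iff_irreducible_map_fraction_map (K := ℚ)).1
      irreducible_maxPoly
  · rw [← hr]
    exact aeval_map_algebraMap ℚ r maxPoly

/-- With A = r^12 + r^9 + r^5 + r^4 + 1 and B = r^13 - 1, the polynomial is B^2 - AB - A^2, which
vanishes when A = gB. -/
theorem aeval_maxPoly_eq_zero {r g : ℝ} (hg : g ^ 2 + g = 1)
    (h : r ^ 12 + r ^ 9 + r ^ 5 + r ^ 4 + 1 = g * (r ^ 13 - 1)) : aeval r maxPoly = 0 := by
  simp only [maxPoly, map_add, map_sub, map_mul, map_pow, aeval_X, map_ofNat, map_one]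
  linear_combination (-(r ^ 12 + r ^ 9 + r ^ 5 + r ^ 4 + 1) - (r ^ 13 - 1) - g * (r ^ 13 - 1)) * h
    - (r ^ 13 - 1) ^ 2 * hg

/-! ### Integer certificates on finite graphs -/

/-- `Lo i / K` and `Up i / K` bracket the values, in base `Q / M`, of the digit sequences read
along the infinite paths that start at the state `i` of the graph with edge list `E`; the state
`i` emits the digit `D i`. -/
def boundsCheck (Q M K : ℕ) (D : List (Fin 2)) (Lo Up : List ℕ) (E : List (ℕ × ℕ)) : Bool :=
  E.all fun e =>
    decide (Q * Lo.getD e.1 0 ≤ M * (K * (D.getD e.1 0 : ℕ) + Lo.getD e.2 0)) &&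
    decide (M * (K * (D.getD e.1 0 : ℕ) + Up.getD e.2 0) ≤ Q * Up.getD e.1 0)

/-- All paths of the graph emit digit sequences that are univoque in base `Q / M`. -/
def univoqueCheck (Q M K : ℕ) (D : List (Fin 2)) (Lo Up : List ℕ) (E : List (ℕ × ℕ)) : Bool :=
  E.all fun e =>
    if D.getD e.1 0 = 0 then decide (Up.getD e.2 0 < K)
    else decide (K * (2 * M) + Lo.getD e.2 0 * M < Lo.getD e.2 0 * Q + K * Q)

theorem exists_le_getD (l : List ℕ) : ∃ B, ∀ i, l.getD i 0 ≤ B := by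
  induction l with
  | nil => exact ⟨0, by simp⟩
  | cons a l ih =>
    obtain ⟨B, hB⟩ := ih
    refine ⟨max a B, fun i => ?_⟩
    cases i with
    | zero => simp
    | succ i => exact (hB i).trans (le_max_right _ _)

section Check

variable {Q M K : ℕ} {D : List (Fin 2)} {Lo Up : List ℕ} {E : List (ℕ × ℕ)} {d : DigitSeq}
  {s : ℕ → ℕ}

/-- The inequality checked on each edge is, after clearing denominators, the hypothesis of the
recurrence comparison lemmas. -/
theorem bounds_of_check (hM : 0 < M) (hK : 0 < K) (hMQ : M < Q)
    (h : boundsCheck Q M K D Lo Up E = true) (hd : ∀ n, d n = D.getD (s n) 0)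
    (hs : ∀ n, (s n, s (n + 1)) ∈ E) (n : ℕ) :
    (Lo.getD (s n) 0 : ℝ) / K ≤ value ((Q : ℝ) / M) (shift n d) ∧
      value ((Q : ℝ) / M) (shift n d) ≤ (Up.getD (s n) 0 : ℝ) / K := by
  have hM' : (0 : ℝ) < M := by exact_mod_cast hM
  have hK' : (0 : ℝ) < K := by exact_mod_cast hK
  have hq : (1 : ℝ) < (Q : ℝ) / M := by
    rw [lt_div_iff₀ hM', one_mul]; exact_mod_cast hMQ
  rw [boundsCheck, List.all_eq_true] at h
  constructor
  · obtain ⟨B, hB⟩ := exists_le_getD Lo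
    refine le_value_of_recurrence hq d (L := fun n => (Lo.getD (s n) 0 : ℝ) / K)
      (B := (B : ℝ) / K) (fun n => ?_) (fun n => ?_) n
    · gcongr; exact hB _
    · have h1 := h _ (hs n)
      simp only [Bool.and_eq_true, decide_eq_true_eq] at h1
      rw [← hd n] at h1
      have h2 : (Q : ℝ) * Lo.getD (s n) 0 ≤ M * (K * ((d n : ℕ) : ℝ) + Lo.getD (s (n + 1)) 0) := by
        exact_mod_cast h1.1
      rw [div_mul_div_comm, div_le_iff₀ (by positivity)]
      refine h2.trans_eq ?_
      field_simp
  · refine value_le_of_recurrence hq d (U := fun n => (Up.getD (s n) 0 : ℝ) / K)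
      (B := 0) (fun n => by positivity) (fun n => ?_) n
    have h1 := h _ (hs n)
    simp only [Bool.and_eq_true, decide_eq_true_eq] at h1
    rw [← hd n] at h1
    have h2 : (M : ℝ) * (K * ((d n : ℕ) : ℝ) + Up.getD (s (n + 1)) 0) ≤ Q * Up.getD (s n) 0 := by
      exact_mod_cast h1.2
    rw [div_mul_div_comm, le_div_iff₀ (by positivity)]
    refine Eq.trans_le ?_ h2
    field_simp

theorem univoqueIn_of_check (hM : 0 < M) (hK : 0 < K) (hMQ : M < Q)
    (h : boundsCheck Q M K D Lo Up E = true) (hu : univoqueCheck Q M K D Lo Up E = true)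
    (hd : ∀ n, d n = D.getD (s n) 0) (hs : ∀ n, (s n, s (n + 1)) ∈ E) :
    UnivoqueIn ((Q : ℝ) / M) d := by
  have hM' : (0 : ℝ) < M := by exact_mod_cast hM
  have hK' : (0 : ℝ) < K := by exact_mod_cast hK
  have hq : (1 : ℝ) < (Q : ℝ) / M := by
    rw [lt_div_iff₀ hM', one_mul]; exact_mod_cast hMQ
  rw [univoqueCheck, List.all_eq_true] at hu
  refine univoqueIn_of_bounds hq (fun n => (bounds_of_check hM hK hMQ h hd hs n).1)
    (fun n => (bounds_of_check hM hK hMQ h hd hs n).2) (fun n hn => ?_) (fun n hn => ?_)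
  · have h1 := hu _ (hs n)
    rw [← hd n, hn, if_pos rfl, decide_eq_true_eq] at h1
    rw [div_lt_one hK']
    exact_mod_cast h1
  · have h1 := hu _ (hs n)
    rw [← hd n, hn, if_neg (by decide), decide_eq_true_eq] at h1
    have h2 : (K : ℝ) * (2 * M) + Lo.getD (s (n + 1)) 0 * M <
        Lo.getD (s (n + 1)) 0 * Q + K * Q := by exact_mod_cast h1
    have e : (Lo.getD (s (n + 1)) 0 : ℝ) / K * ((Q : ℝ) / M - 1) - (2 - (Q : ℝ) / M) =
        (Lo.getD (s (n + 1)) 0 * Q + K * Q - (K * (2 * M) + Lo.getD (s (n + 1)) 0 * M)) /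
          (K * M) := by
      field_simp; ring
    have : 0 < (Lo.getD (s (n + 1)) 0 : ℝ) / K * ((Q : ℝ) / M - 1) - (2 - (Q : ℝ) / M) := by
      rw [e]
      apply div_pos <;> [linarith; positivity]
    linarith

end Check

/-- The state at time `n` of the path `0, 1, …, a + b - 1` that returns to `a` at its end. -/
def lasso (a b n : ℕ) : ℕ := if n < a then n else a + (n - a) % b

/-- The edges of the path `0, 1, …, a + b - 1` that returns to `a` at its end. -/
def lassoEdges (a b : ℕ) : List (ℕ × ℕ) :=
  (List.range (a + b)).map fun i => (i, if i + 1 = a + b then a else i + 1)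

theorem lasso_mem_edges {a b : ℕ} (hb : 0 < b) (n : ℕ) :
    (lasso a b n, lasso a b (n + 1)) ∈ lassoEdges a b := by
  simp only [lassoEdges, List.mem_map, List.mem_range, Prod.mk.injEq]
  refine ⟨lasso a b n, ?_, rfl, ?_⟩
  · unfold lasso
    have := Nat.mod_lt (n - a) hb
    split_ifs <;> omega
  · unfold lasso
    by_cases h1 : n < a
    · by_cases h2 : n + 1 < a
      · simp [h1, h2]; omega
      · have : n + 1 - a = 0 := by omega
        simp [h1, h2, this]; omega
    · have e : n + 1 - a = (n - a) + 1 := by omega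
      have h2 : ¬ n + 1 < a := by omega
      simp only [h1, h2, if_false, e]
      have := Nat.mod_lt (n - a) hb
      rcases Nat.lt_or_ge ((n - a) % b + 1) b with h | h
      · rw [if_neg (by omega), Nat.add_mod, Nat.mod_eq_of_lt (a := 1) (by omega),
          Nat.mod_eq_of_lt h]; rfl
      · have h' : (n - a) % b + 1 = b := by omega
        rw [if_pos (by omega), ← Nat.mod_add_mod, h', Nat.mod_self]; rfl

theorem eventuallyPeriodic_eq_lasso (u v : List (Fin 2)) (n : ℕ) :
    eventuallyPeriodic u v n = (u ++ v).getD (lasso u.length v.length n) 0 := by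
  unfold eventuallyPeriodic lasso
  split_ifs with h
  · rw [List.getD_append _ _ _ _ h]
  · rw [List.getD_append_right _ _ _ _ (by omega)]; simp

/-- Approximate values, scaled by `K`, in base `Q / M`, of all suffixes of a word that is followed
by a sequence of scaled value `t`. -/
def scaledTails (Q M K : ℕ) (t : ℕ) : List (Fin 2) → List ℕ
  | [] => [t]
  | a :: l => (M * (K * a + (scaledTails Q M K t l).headD 0)) / Q :: scaledTails Q M K t l

/-- The approximate value, scaled by `K`, of the purely periodic sequence `v^∞`. -/
def scaledPeriodic (Q M K : ℕ) (v : List (Fin 2)) : ℕ → ℕ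
  | 0 => 0
  | m + 1 => (scaledTails Q M K (scaledPeriodic Q M K v m) v).headD 0

/-- Scaled approximate values of the tails of `u v^∞`. -/
def scaledLasso (Q M K : ℕ) (u v : List (Fin 2)) : List ℕ :=
  -- Seventy rounds make the truncation of v^∞ negligible; nothing depends on this, since
  -- `boundsCheck` verifies the resulting numbers. The list ends with one extra entry, which the
  -- lasso never visits.
  scaledTails Q M K (scaledPeriodic Q M K v 70) (u ++ v)

/-- Certificate that the value of `u v^∞` in base `Q / 10 ^ 10` lies between `lo / 10 ^ 15` and
`up / 10 ^ 15`. -/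
def certBounds (Q : ℕ) (u v : List (Fin 2)) (lo up : ℕ) : Bool :=
  let L := scaledLasso Q (10 ^ 10) (10 ^ 15) u v
  -- The margin of 10 units absorbs the errors of the floor divisions.
  let Lo := L.map (· - 10)
  let Up := L.map (· + 10)
  boundsCheck Q (10 ^ 10) (10 ^ 15) (u ++ v) Lo Up (lassoEdges u.length v.length) &&
    decide (lo ≤ Lo.headD 0) && decide (Up.headD 0 ≤ up) && decide (10 ^ 10 < Q) &&
    decide (0 < v.length)

/-- Certificate that `u v^∞` is univoque in base `Q / 10 ^ 10`. -/
def certUnivoque (Q : ℕ) (u v : List (Fin 2)) : Bool :=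
  let L := scaledLasso Q (10 ^ 10) (10 ^ 15) u v
  let Lo := L.map (· - 10)
  let Up := L.map (· + 10)
  boundsCheck Q (10 ^ 10) (10 ^ 15) (u ++ v) Lo Up (lassoEdges u.length v.length) &&
    univoqueCheck Q (10 ^ 10) (10 ^ 15) (u ++ v) Lo Up (lassoEdges u.length v.length) &&
    decide (10 ^ 10 < Q) && decide (0 < v.length)

theorem getD_zero_eq_headD (l : List ℕ) : l.getD 0 0 = l.headD 0 := by
  cases l <;> rfl

theorem lasso_zero (a b : ℕ) : lasso a b 0 = 0 := by
  unfold lasso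
  split_ifs with h
  · rfl
  · simp; omega

theorem value_mem_of_cert {Q lo up : ℕ} {u v : List (Fin 2)} (h : certBounds Q u v lo up = true) :
    (lo : ℝ) / 10 ^ 15 ≤ value ((Q : ℝ) / 10 ^ 10) (eventuallyPeriodic u v) ∧
      value ((Q : ℝ) / 10 ^ 10) (eventuallyPeriodic u v) ≤ (up : ℝ) / 10 ^ 15 := by
  simp only [certBounds, Bool.and_eq_true, decide_eq_true_eq] at h
  obtain ⟨⟨⟨⟨h1, h2⟩, h3⟩, h4⟩, h5⟩ := h
  have := bounds_of_check (by norm_num) (by norm_num) h4 h1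
    (eventuallyPeriodic_eq_lasso u v) (lasso_mem_edges h5) 0
  rw [shift_zero, lasso_zero, getD_zero_eq_headD, getD_zero_eq_headD] at this
  simp only [Nat.cast_pow, Nat.cast_ofNat] at this
  constructor
  · refine le_trans ?_ this.1
    gcongr
  · refine this.2.trans ?_
    gcongr

theorem univoqueIn_of_cert {Q : ℕ} {u v : List (Fin 2)} (h : certUnivoque Q u v = true) :
    UnivoqueIn ((Q : ℝ) / 10 ^ 10) (eventuallyPeriodic u v) := by
  simp only [certUnivoque, Bool.and_eq_true, decide_eq_true_eq] at h
  obtain ⟨⟨⟨h1, h2⟩, h4⟩, h5⟩ := h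
  have := univoqueIn_of_check (by norm_num) (by norm_num) h4 h1 h2
    (eventuallyPeriodic_eq_lasso u v) (lasso_mem_edges h5)
  exact_mod_cast this

/-! ### The critical sequence and the critical base -/

/-- The period `0010001100011`. -/
def periodWord : List (Fin 2) := [0, 0, 1, 0, 0, 0, 1, 1, 0, 0, 0, 1, 1]

/-- The sequence `1 (0010001100011)^∞`. -/
def critSeq : DigitSeq := eventuallyPeriodic [1] periodWord

theorem critSeq_zero : critSeq 0 = 1 := rfl

theorem critSeq_eq : eventuallyPeriodic [1, 0, 0] [1, 0, 0, 0, 1, 1, 0, 0, 0, 1, 1, 0, 0] =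
    critSeq := by
  funext n
  by_cases h : n < 3
  · interval_cases n <;> rfl
  · have h1 : (n - 1) % 13 = ((n - 3) % 13 + 2) % 13 := by omega
    have h2 : (n - 3) % 13 < 13 := Nat.mod_lt _ (by norm_num)
    have h3 : ¬ n < 1 := by omega
    simp only [critSeq, periodWord, eventuallyPeriodic, List.length_cons, List.length_nil,
      Nat.zero_add, Nat.reduceAdd, h, h3, if_false, h1]
    generalize (n - 3) % 13 = m at h2
    interval_cases m <;> rfl

theorem shift_critSeq (n : ℕ) : shift (n + 14) critSeq = shift (n + 1) critSeq := by
  funext i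
  have h1 : ¬ n + 14 + i < 1 := by omega
  have h2 : ¬ n + 1 + i < 1 := by omega
  have h3 : (n + 14 + i - 1) % 13 = (n + 1 + i - 1) % 13 := by omega
  simp only [shift, critSeq, periodWord, eventuallyPeriodic, List.length_cons, List.length_nil,
    Nat.zero_add, Nat.reduceAdd, h1, h2, if_false, h3]

theorem inv_goldenRatio : 1 / Real.goldenRatio = (Real.sqrt 5 - 1) / 2 := by
  rw [one_div, Real.inv_goldenRatio, Real.goldenConj]
  ring

theorem inv_goldenRatio_sq : (1 / Real.goldenRatio) ^ 2 + 1 / Real.goldenRatio = 1 := by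
  rw [inv_goldenRatio]
  have := Real.sq_sqrt (show (0 : ℝ) ≤ 5 by norm_num)
  linear_combination this / 4

theorem inv_goldenRatio_bounds :
    0.61803398874 < 1 / Real.goldenRatio ∧ 1 / Real.goldenRatio < 0.61803398875 := by
  have h := inv_goldenRatio_sq
  have h0 : 0 < 1 / Real.goldenRatio := by positivity
  constructor <;> by_contra! hc <;> nlinarith

theorem exists_critical_base : ∃ r : ℝ, 1.8884533277 < r ∧ r < 1.8884533284 ∧
    value r critSeq = 1 / Real.goldenRatio := by
  have ha := (value_mem_of_cert (Q := 18884533277) (u := [1]) (v := periodWord)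
    (lo := 618033988900000) (up := 10 ^ 16) (by decide +kernel)).1
  have hb := (value_mem_of_cert (Q := 18884533284) (u := [1]) (v := periodWord)
    (lo := 0) (up := 618033988700000) (by decide +kernel)).2
  have hx := inv_goldenRatio_bounds
  have hab : ((18884533277 : ℕ) : ℝ) / 10 ^ 10 ≤ ((18884533284 : ℕ) : ℝ) / 10 ^ 10 := by norm_num
  obtain ⟨r, hr, hrx⟩ := intermediate_value_Ioo' hab
    ((continuousOn_value critSeq).mono fun y hy => by
      have := hy.1
      norm_num at this ⊢
      linarith) (show 1 / Real.goldenRatio ∈ _ from ⟨hb.trans_lt (by norm_num at *; linarith),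
      lt_of_lt_of_le (by norm_num at *; linarith) ha⟩)
  refine ⟨r, ?_, ?_, hrx⟩
  · have := hr.1; norm_num at this ⊢; linarith
  · have := hr.2; norm_num at this ⊢; linarith

/-- Unrolling the tail recurrence over the first 14 digits returns to the tail after the first
digit; eliminating the tails leaves this relation. -/
theorem value_critSeq_poly {q : ℝ} (hq : 1 < q) :
    q ^ 12 + q ^ 9 + q ^ 5 + q ^ 4 + 1 = value q critSeq * (q ^ 13 - 1) := by
  have h := fun n => mul_value_shift hq critSeq n
  have h0 := h 0
  have h1 := h 1
  have h2 := h 2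
  have h3 := h 3
  have h4 := h 4
  have h5 := h 5
  have h6 := h 6
  have h7 := h 7
  have h8 := h 8
  have h9 := h 9
  have h10 := h 10
  have h11 := h 11
  have h12 := h 12
  have h13 := h 13
  rw [shift_critSeq 0] at h13
  have d0 : critSeq 0 = 1 := rfl
  have d1 : critSeq 1 = 0 := rfl
  have d2 : critSeq 2 = 0 := rfl
  have d3 : critSeq 3 = 1 := rfl
  have d4 : critSeq 4 = 0 := rfl
  have d5 : critSeq 5 = 0 := rfl
  have d6 : critSeq 6 = 0 := rfl
  have d7 : critSeq 7 = 1 := rfl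
  have d8 : critSeq 8 = 1 := rfl
  have d9 : critSeq 9 = 0 := rfl
  have d10 : critSeq 10 = 0 := rfl
  have d11 : critSeq 11 = 0 := rfl
  have d12 : critSeq 12 = 1 := rfl
  have d13 : critSeq 13 = 1 := rfl
  simp only [d0, d1, d2, d3, d4, d5, d6, d7, d8, d9, d10, d11, d12, d13, Fin.val_zero, Fin.val_one,
    Nat.cast_zero, Nat.cast_one, shift_zero, Nat.reduceAdd] at *
  have hq0 : q ≠ 0 := by linarith
  refine mul_left_cancel₀ hq0 ?_
  linear_combination (1 - q ^ 13) * h0 - q ^ 12 * h1 - q ^ 11 * h2 - q ^ 10 * h3 - q ^ 9 * h4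
    - q ^ 8 * h5 - q ^ 7 * h6 - q ^ 6 * h7 - q ^ 5 * h8 - q ^ 4 * h9 - q ^ 3 * h10 - q ^ 2 * h11
    - q * h12 - h13

theorem univoqueIn_critSeq {q : ℝ} (hq : 1.888445 ≤ q) : UnivoqueIn q critSeq := by
  have h := univoqueIn_of_cert (Q := 18884450000) (u := [1]) (v := periodWord) (by decide +kernel)
  refine h.mono (by norm_num) ?_
  norm_num at hq ⊢
  linarith

/-! ### Smaller bases for every other x -/

section Cover

variable {r x : ℝ}

/-- One sequence serves the whole interval (`up`, `lo`]: `up` bounds its value just below r, hence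
at r, and `lo` its value at the smaller base. The bounds 0 and `10 ^ 16` are dummies. -/
theorem exists_base_lt_of_cert (hr : 1.8884533277 < r) (hr2 : r ≤ 2) {Q : ℕ} {u v : List (Fin 2)}
    (lo up : ℕ) (hQ : Q ≤ 18884533277) (hQ1 : 10 ^ 10 < Q) (hu : certUnivoque Q u v = true)
    (h1 : certBounds 18884533277 u v 0 up = true) (h2 : certBounds Q u v lo (10 ^ 16) = true)
    (hx1 : (up : ℝ) / 10 ^ 15 < x) (hx2 : x ≤ (lo : ℝ) / 10 ^ 15) :
    ∃ q ∈ univoqueBases x, q < r := by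
  have hQ' : (Q : ℝ) ≤ 18884533277 := by exact_mod_cast hQ
  have hQ1' : (10 : ℝ) ^ 10 < Q := by exact_mod_cast hQ1
  refine (univoqueIn_of_cert hu).exists_base_lt ?_ ?_ hr2 ?_ (hx2.trans (value_mem_of_cert h2).1)
  · rwa [lt_div_iff₀ (by positivity), one_mul]
  · rw [div_le_iff₀ (by positivity)]
    norm_num at hr ⊢
    linarith
  · refine lt_of_le_of_lt ?_ hx1
    refine le_trans (value_antitone ?_ ?_ _) (value_mem_of_cert h1).2
    · norm_num
    · norm_num at hr ⊢
      linarith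

theorem univoqueIn_ones {q : ℝ} (hq : 1 < q) :
    UnivoqueIn q (fun _ => 1) ∧ value q (fun _ => 1) = 1 / (q - 1) := by
  have h : value q (fun _ => 1) = 1 / (q - 1) := by
    rw [← (hasSum_ones hq).tsum_eq]
    simp [value]
  refine ⟨fun n => ⟨fun h0 => absurd h0 one_ne_zero, fun _ => ?_⟩, h⟩
  have := value_add_compl hq (fun _ => 1)
  change value q (compl (fun _ => 1)) < 1
  linarith

theorem exists_base_lt_of_large (hr : 1.8884533277 < r) (hx : 1.13 ≤ x) :
    ∃ q ∈ univoqueBases x, q < r := by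
  have h0 : 0 < x := by linarith
  have hq : 1 < 1 + 1 / x := by
    have : 0 < 1 / x := by positivity
    linarith
  have h1 : 1 / x ≤ 0.885 := by
    rw [div_le_iff₀ h0]; norm_num at hx ⊢; linarith
  obtain ⟨hu, hv⟩ := univoqueIn_ones hq
  refine ⟨1 + 1 / x, hu.mem_univoqueBases hq (by norm_num at h1 ⊢; linarith) ?_, ?_⟩
  · rw [hv]; simp
  · norm_num at h1 hr ⊢; linarith

/-- The sequence `0^k (01)^∞`. -/
def zerosSeq : ℕ → DigitSeq
  | 0 => fun n => if n % 2 = 1 then 1 else 0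
  | k + 1 => consSeq 0 (zerosSeq k)

theorem value_zerosSeq {q : ℝ} (hq : 1 < q) (k : ℕ) :
    value q (zerosSeq k) = 1 / (q ^ 2 - 1) / q ^ k := by
  have hq2 : 0 < q ^ 2 - 1 := by nlinarith
  induction k with
  | zero =>
    have h0 := mul_value_shift hq (zerosSeq 0) 0
    have h1 := mul_value_shift hq (zerosSeq 0) 1
    have h2 : shift (1 + 1) (zerosSeq 0) = zerosSeq 0 := by
      funext i; simp [shift, zerosSeq, add_comm]
    rw [h2] at h1
    rw [shift_zero] at h0
    simp [zerosSeq] at h0 h1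
    rw [pow_zero, div_one, eq_div_iff hq2.ne']
    simp only [zerosSeq]
    linear_combination q * h0 + h1
  | succ k ih =>
    have h := value_consSeq hq 0 (zerosSeq k)
    rw [ih] at h
    have hq0 : q ≠ 0 := by linarith
    refine mul_left_cancel₀ hq0 ?_
    change q * value q (consSeq 0 (zerosSeq k)) = _
    rw [h]
    simp [pow_succ]
    field_simp

theorem univoqueIn_consSeq_zero {q : ℝ} {d : DigitSeq} (hd : UnivoqueIn q d) (h : value q d < 1) :
    UnivoqueIn q (consSeq 0 d) := by
  intro n
  have e : ∀ m, shift (m + 1) (consSeq 0 d) = shift m d := by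
    intro m; funext i
    simp only [shift]
    rw [show m + 1 + i = (m + i) + 1 by omega]
    rfl
  rw [e]
  cases n with
  | zero => exact ⟨fun _ => by rwa [shift_zero], fun h1 => absurd h1 (by simp [consSeq])⟩
  | succ n => exact hd n

theorem univoqueIn_zerosSeq {q : ℝ} (hq : 1 < q) (hqg : q + 1 < q ^ 2) (k : ℕ) :
    UnivoqueIn q (zerosSeq k) := by
  have hq2 : 0 < q ^ 2 - 1 := by nlinarith
  induction k with
  | zero =>
    have hs : ∀ n, n % 2 = 0 → shift n (zerosSeq 0) = zerosSeq 0 := by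
      intro n hn; funext i
      simp [shift, zerosSeq, Nat.add_mod, hn]
    have hv := value_zerosSeq hq 0
    rw [pow_zero, div_one] at hv
    intro n
    rcases Nat.mod_two_eq_zero_or_one n with hn | hn
    · refine ⟨fun _ => ?_, fun h => absurd h (by simp [zerosSeq, hn])⟩
      have h1 := mul_value_shift hq (zerosSeq 0) n
      rw [hs n hn, hv] at h1
      simp [zerosSeq, hn] at h1
      simp only [zerosSeq]
      rw [← h1, ← div_eq_mul_inv, div_lt_one hq2]
      linarith
    · refine ⟨fun h => absurd h (by simp [zerosSeq, hn]), fun _ => ?_⟩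
      rw [hs (n + 1) (by omega)]
      have h1 := value_add_compl hq (zerosSeq 0)
      rw [hv] at h1
      have h2 : 1 / (q - 1) - 1 / (q ^ 2 - 1) = q / (q ^ 2 - 1) := by
        have : q - 1 ≠ 0 := by linarith
        have : q + 1 ≠ 0 := by linarith
        rw [show q ^ 2 - 1 = (q - 1) * (q + 1) by ring]
        field_simp; ring
      have h3 : q / (q ^ 2 - 1) < 1 := by rw [div_lt_one hq2]; linarith
      linarith
  | succ k ih =>
    refine univoqueIn_consSeq_zero ih ?_
    rw [value_zerosSeq hq, div_div, div_lt_one (by positivity)]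
    have := one_le_pow₀ hq.le (n := k)
    nlinarith

theorem exists_base_lt_of_small (hr : 1.8884533277 < r) (hr2 : r < 1.8884533284) (hx0 : 0 < x)
    (hx : x < 1 / Real.goldenRatio) : ∃ q ∈ univoqueBases x, q < r := by
  norm_num at hr hr2
  have hr1 : 1 < r := by linarith
  have hrsq : 2.5662 < r ^ 2 - 1 := by norm_num; nlinarith
  have hrsq' : r ^ 2 - 1 < 2.5663 := by norm_num; nlinarith
  norm_num at hrsq hrsq'
  have hu : UnivoqueIn 1.63 (zerosSeq 0) := univoqueIn_zerosSeq (by norm_num) (by norm_num) 0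
  have hex : ∃ k, value r (zerosSeq k) < x := by
    obtain ⟨k, hk⟩ := pow_unbounded_of_one_lt (1 / (r ^ 2 - 1) / x) hr1
    refine ⟨k, ?_⟩
    rw [value_zerosSeq hr1, div_lt_iff₀ (by positivity)]
    rw [div_lt_iff₀ hx0] at hk
    linarith
  classical
  -- The least k puts x between the values in base r of 0^k(01)^∞ and 0^(k-1)(01)^∞.
  let k := Nat.find hex
  have hk : value r (zerosSeq k) < x := Nat.find_spec hex
  have hmin : ∀ j < k, x ≤ value r (zerosSeq j) := fun j hj => not_lt.1 (Nat.find_min hex hj)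
  rcases Nat.lt_or_ge k 1 with h0 | h0
  · have hk0 : k = 0 := by omega
    rw [hk0, value_zerosSeq hr1, pow_zero, div_one, div_lt_iff₀ (by linarith)] at hk
    -- For k = 0 the equation 1/(q^2 - 1) = x is solved explicitly; x < g says exactly that this q
    -- exceeds the golden ratio. A fixed base such as 1.63 would miss x close to g.
    have hs : Real.sqrt (1 + 1 / x) ^ 2 = 1 + 1 / x := Real.sq_sqrt (by positivity)
    have hxinv : x * (1 / x) = 1 := by field_simp
    have hg := inv_goldenRatio_sq
    have hg0 : 0 < 1 / Real.goldenRatio := by positivity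
    set g := 1 / Real.goldenRatio
    set q := Real.sqrt (1 + 1 / x) with hqdef
    have hq0 : 0 ≤ q := Real.sqrt_nonneg _
    have hix : 1 / g < 1 / x := one_div_lt_one_div_of_lt hx0 hx
    have hig : 1 / g = 1 + g := by
      rw [div_eq_iff hg0.ne']; linear_combination -hg
    have hq1 : 1 + g < q := by
      refine lt_of_pow_lt_pow_left₀ 2 hq0 ?_
      rw [hs]; nlinarith
    have hqr : q < r := by
      refine lt_of_pow_lt_pow_left₀ 2 (by linarith) ?_
      rw [hs]
      have : 1 / x < r ^ 2 - 1 := by rw [div_lt_iff₀ hx0]; linarith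
      linarith
    refine ⟨q, (univoqueIn_zerosSeq (by linarith) ?_ 0).mem_univoqueBases (by linarith)
      (by linarith) ?_, hqr⟩
    · nlinarith
    · rw [value_zerosSeq (by linarith), hs]; simp
  have hval : ∀ m, x ≤ 1 / (1.63 ^ 2 - 1) / 1.63 ^ m → value r (zerosSeq m) < x →
      ∃ q ∈ univoqueBases x, q < r := by
    intro m hm1 hm2
    refine (univoqueIn_zerosSeq (q := 1.63) (by norm_num) (by norm_num) m).exists_base_lt
      (by norm_num) (by norm_num; linarith) (by linarith) hm2 ?_
    rwa [value_zerosSeq (by norm_num)]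
  have hk' := hmin (k - 1) (by omega)
  rw [value_zerosSeq hr1, le_div_iff₀ (by positivity), le_div_iff₀ (by linarith)] at hk'
  rcases Nat.lt_or_ge k 2 with h1 | h1
  · have hk1 : k = 1 := by omega
    rcases le_or_gt x 0.37 with h2 | h2
    · refine hval k ?_ hk
      rw [hk1]; norm_num at h2 ⊢; linarith
    -- For k = 1, base 1.63 reaches only slightly beyond 0.37, short of 1/(r^2 - 1); 0(1001)^∞
    -- closes the gap.
    · rw [hk1] at hk'
      simp only [Nat.sub_self, pow_zero, mul_one] at hk'
      refine exists_base_lt_of_cert (Q := 17600000000) (u := [0]) (v := [1, 0, 0, 1])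
        (by norm_num; linarith) (by linarith)
        420000000000000 350000000000000 (by norm_num) (by norm_num) (by decide +kernel)
        (by decide +kernel) (by decide +kernel) ?_ ?_
      · norm_num at h2 ⊢; linarith
      · norm_num; nlinarith
  · refine hval k ?_ hk
    have e : k = (k - 2) + 2 := by omega
    have e1 : k - 1 = (k - 2) + 1 := by omega
    rw [e1] at hk'
    rw [e, le_div_iff₀ (by positivity), le_div_iff₀ (by norm_num)]
    have hp : (1.63 : ℝ) ^ (k - 2) ≤ r ^ (k - 2) := by
      apply pow_le_pow_left₀ (by norm_num); norm_num; linarith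
    have hr0 : 0 < r ^ (k - 2) := by positivity
    rw [pow_succ] at hk'
    rw [pow_add]
    have h5 : x * (1.63 : ℝ) ^ (k - 2) ≤ x * r ^ (k - 2) := by gcongr
    have h6 : 0 < x * r ^ (k - 2) := by positivity
    have h7 : (1.63 : ℝ) ^ 2 * (1.63 ^ 2 - 1) ≤ r * (r ^ 2 - 1) := by norm_num; nlinarith
    calc x * ((1.63 : ℝ) ^ (k - 2) * 1.63 ^ 2) * (1.63 ^ 2 - 1)
        = x * (1.63 : ℝ) ^ (k - 2) * (1.63 ^ 2 * (1.63 ^ 2 - 1)) := by ring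
      _ ≤ x * r ^ (k - 2) * (r * (r ^ 2 - 1)) := by gcongr
      _ ≤ 1 := by linarith

/-- The digits emitted by the states of the graph that generates the sequences `1 w^m v`, with
`w = 0010001100011` and `v = 0010(0011)^∞`. -/
def familyDigits : List (Fin 2) := [1] ++ periodWord ++ [0, 0, 1, 0, 0, 0, 1, 1]

/-- The graph that generates the sequences `1 w^m v`, `m ≥ 1`. -/
def familyEdges : List (ℕ × ℕ) :=
  (List.range 21).map (fun i => (i, i + 1)) ++ [(13, 1), (21, 18)]

/-- The path of `1 w^m v`. -/
def familyPath (m n : ℕ) : ℕ :=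
  if n = 0 then 0 else if n ≤ 13 * m then 1 + (n - 1) % 13
  else if n - 13 * m ≤ 4 then 13 + (n - 13 * m) else 18 + (n - 13 * m - 5) % 4

/-- The sequence `1 w^m v` with `w = 0010001100011` and `v = 0010(0011)^∞`. -/
def familySeq (m : ℕ) : DigitSeq := fun n => familyDigits.getD (familyPath m n) 0

theorem familyPath_mem {m : ℕ} (hm : 1 ≤ m) (n : ℕ) :
    (familyPath m n, familyPath m (n + 1)) ∈ familyEdges := by
  simp only [familyEdges, List.mem_append, List.mem_map, List.mem_range, Prod.mk.injEq,
    List.mem_cons, List.not_mem_nil, or_false]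
  have key : (familyPath m n < 21 ∧ familyPath m (n + 1) = familyPath m n + 1) ∨
      (familyPath m n = 13 ∧ familyPath m (n + 1) = 1) ∨
      (familyPath m n = 21 ∧ familyPath m (n + 1) = 18) := by
    unfold familyPath
    split_ifs <;> first | contradiction | omega
  rcases key with h | h | h
  · exact Or.inl ⟨_, h.1, rfl, h.2.symm⟩
  · exact Or.inr (Or.inl h)
  · exact Or.inr (Or.inr h)

/-- Scaled lower bounds for the states of the graph of the family. -/
def familyLo (Q : ℕ) : List ℕ :=
  -- At the branch w^∞ is lexicographically below v, so always looping gives the lower bounds on the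
  -- first 14 states, and `familyUp` uses a single w followed by v. `take 14` drops the unused last
  -- entry.
  (((scaledLasso Q (10 ^ 10) (10 ^ 15) [1] periodWord).take 14) ++
    scaledLasso Q (10 ^ 10) (10 ^ 15) [0, 0, 1, 0] [0, 0, 1, 1]).map (· - 10)

/-- Scaled upper bounds for the states of the graph of the family. -/
def familyUp (Q : ℕ) : List ℕ :=
  (scaledLasso Q (10 ^ 10) (10 ^ 15) ([1] ++ periodWord ++ [0, 0, 1, 0]) [0, 0, 1, 1]).map (· + 10)

theorem familySeq_bounds {m : ℕ} (hm : 1 ≤ m) :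
    UnivoqueIn 1.888445 (familySeq m) ∧ 0.6180379 ≤ value 1.888445 (familySeq m) := by
  have hb : boundsCheck 18884450000 (10 ^ 10) (10 ^ 15) familyDigits (familyLo 18884450000)
    (familyUp 18884450000) familyEdges = true := by decide +kernel
  have hu := univoqueIn_of_check (by norm_num) (by norm_num) (by norm_num) hb (by decide +kernel)
    (d := familySeq m) (fun _ => rfl) (familyPath_mem hm)
  have hv := (bounds_of_check (by norm_num) (by norm_num) (by norm_num) hb
    (d := familySeq m) (fun _ => rfl) (familyPath_mem hm) 0).1
  have e : (((18884450000 : ℕ) : ℝ) / ((10 ^ 10 : ℕ) : ℝ)) = 1.888445 := by norm_num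
  rw [e] at hu hv
  refine ⟨hu, ?_⟩
  rw [shift_zero] at hv
  refine le_trans ?_ hv
  have h0 : familyPath m 0 = 0 := rfl
  have h1 : 618037900000000 ≤ (familyLo 18884450000).getD 0 0 := by decide +kernel
  have h2 : (618037900000000 : ℝ) ≤ ((familyLo 18884450000).getD 0 0 : ℕ) := by exact_mod_cast h1
  rw [h0, le_div_iff₀ (by positivity)]
  refine le_trans ?_ h2
  norm_num

theorem familySeq_agree (m i : ℕ) (hi : i < 13 * m) : familySeq m i = critSeq i := by
  have e : familyPath m i = lasso 1 13 i := by
    unfold familyPath lasso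
    split_ifs <;> omega
  have h14 : lasso 1 13 i < 14 := by
    unfold lasso
    split_ifs <;> omega
  rw [critSeq, eventuallyPeriodic_eq_lasso, familySeq, e]
  change familyDigits.getD (lasso 1 13 i) 0 = ([1] ++ periodWord).getD (lasso 1 13 i) 0
  rw [familyDigits, List.getD_append _ _ _ _ h14]

theorem exists_base_lt_of_near (hr : 1.8884533277 < r) (hr2 : r ≤ 2)
    (hv : value r critSeq < x) (hx : x ≤ 0.6180379) : ∃ q ∈ univoqueBases x, q < r := by
  norm_num at hr
  have hr1 : 1 < r := by linarith
  -- Choose m so large that, in base r, agreement with the critical sequence on 13(m+1) digits keeps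
  -- the family member below x. The base 1.888445 does not depend on m.
  obtain ⟨m, hm⟩ := pow_unbounded_of_one_lt (1 / (r - 1) / (x - value r critSeq)) hr1
  obtain ⟨hu, hlo⟩ := familySeq_bounds (m := m + 1) (by omega)
  refine hu.exists_base_lt (by norm_num) (by norm_num; linarith) hr2 ?_ (hx.trans hlo)
  have h1 := value_le_add_of_agree hr1 (13 * (m + 1)) (familySeq_agree (m + 1))
  have h2 : r ^ m ≤ r ^ (13 * (m + 1)) := pow_le_pow_right₀ hr1.le (by omega)
  have h3 : 1 / (r - 1) / r ^ (13 * (m + 1)) < x - value r critSeq := by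
    rw [div_lt_iff₀ (by linarith)] at hm
    rw [div_lt_iff₀ (by positivity)]
    nlinarith
  linarith

theorem exists_base_lt_of_gt (hr : 1.8884533277 < r) (hr2 : r ≤ 2)
    (hv : value r critSeq < x) : ∃ q ∈ univoqueBases x, q < r := by
  rcases le_or_gt x 0.6180379 with h | h
  · exact exists_base_lt_of_near hr hr2 hv h
  rcases le_or_gt x 0.618064 with h' | h'
  · exact exists_base_lt_of_cert (Q := 18883932000)
      (u := [1, 0, 0, 1, 0, 0, 0, 1, 1, 0, 0, 0, 1, 1, 0, 0, 1, 0, 1, 0, 0, 0, 1, 1, 0])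
      (v := [0, 0, 1, 1]) hr hr2 618064000000000 618037900000000 (by norm_num) (by norm_num)
      (by decide +kernel) (by decide +kernel) (by decide +kernel)
      (by norm_num at h ⊢; linarith) (by norm_num at h' ⊢; linarith)
  clear h
  rcases le_or_gt x 0.618259 with h | h
  · exact exists_base_lt_of_cert (Q := 18880529000)
      (u := [1, 0, 0, 1, 0, 0, 0, 1, 1, 0, 0, 0, 1, 1, 0, 1, 0, 1, 0, 1, 0])
      (v := [0, 0, 1, 1]) hr hr2 618259000000000 618064000000000 (by norm_num) (by norm_num)
      (by decide +kernel) (by decide +kernel) (by decide +kernel)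
      (by norm_num at h' ⊢; linarith) (by norm_num at h ⊢; linarith)
  clear h'
  rcases le_or_gt x 0.6197 with h' | h'
  · exact exists_base_lt_of_cert (Q := 18855000000)
      (u := [1, 0, 0, 1, 0, 0, 0, 1, 1, 0, 0, 1, 0, 1, 0])
      (v := [0, 0, 1, 1]) hr hr2 619700000000000 618259000000000 (by norm_num) (by norm_num)
      (by decide +kernel) (by decide +kernel) (by decide +kernel)
      (by norm_num at h ⊢; linarith) (by norm_num at h' ⊢; linarith)
  clear h
  rcases le_or_gt x 0.63 with h | h
  · exact exists_base_lt_of_cert (Q := 18670000000) (u := [1, 0, 0, 1]) (v := [0, 0, 0, 1, 1, 1])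
      hr hr2 630000000000000 619700000000000 (by norm_num) (by norm_num)
      (by decide +kernel) (by decide +kernel) (by decide +kernel)
      (by norm_num at h' ⊢; linarith) (by norm_num at h ⊢; linarith)
  clear h'
  rcases le_or_gt x 0.645 with h' | h'
  · exact exists_base_lt_of_cert (Q := 18400000000) (u := [1, 0, 0, 1, 0, 0]) (v := [1, 0])
      hr hr2 645000000000000 630000000000000 (by norm_num) (by norm_num)
      (by decide +kernel) (by decide +kernel) (by decide +kernel)
      (by norm_num at h ⊢; linarith) (by norm_num at h' ⊢; linarith)
  clear h
  rcases le_or_gt x 0.68 with h | h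
  · exact exists_base_lt_of_cert (Q := 18100000000) (u := [1, 0, 0]) (v := [1, 0])
      hr hr2 680000000000000 645000000000000 (by norm_num) (by norm_num)
      (by decide +kernel) (by decide +kernel) (by decide +kernel)
      (by norm_num at h' ⊢; linarith) (by norm_num at h ⊢; linarith)
  clear h'
  rcases le_or_gt x 0.74 with h' | h'
  · exact exists_base_lt_of_cert (Q := 17600000000) (u := []) (v := [1, 0, 0, 1])
      hr hr2 740000000000000 680000000000000 (by norm_num) (by norm_num)
      (by decide +kernel) (by decide +kernel) (by decide +kernel)
      (by norm_num at h ⊢; linarith) (by norm_num at h' ⊢; linarith)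
  clear h
  rcases le_or_gt x 0.93 with h | h
  · exact exists_base_lt_of_cert (Q := 16600000000) (u := []) (v := [1, 0])
      hr hr2 930000000000000 740000000000000 (by norm_num) (by norm_num)
      (by decide +kernel) (by decide +kernel) (by decide +kernel)
      (by norm_num at h' ⊢; linarith) (by norm_num at h ⊢; linarith)
  rcases le_or_gt x 1.2 with h'' | h''
  · exact exists_base_lt_of_cert (Q := 16200000000) (u := [1]) (v := [1, 0])
      hr hr2 1200000000000000 930000000000000 (by norm_num) (by norm_num)
      (by decide +kernel) (by decide +kernel) (by decide +kernel)
      (by norm_num at h ⊢; linarith) (by norm_num at h'' ⊢; linarith)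
  · exact exists_base_lt_of_large hr (by norm_num at h'' ⊢; linarith)

end Cover

/-! ### Orbits avoiding the switch region -/

/-- Successive tails of an expansion in base `q` that avoid the switch region
`[1 / q, 1 / (q (q - 1))]`. -/
structure AvoidsSwitch (q : ℝ) (t : ℕ → ℝ) : Prop where
  low : ∀ n, q * t n < 1 → t (n + 1) = q * t n
  high : ∀ n, 1 ≤ q * t n → 1 < q * (q - 1) * t n ∧ t (n + 1) = q * t n - 1

theorem avoidsSwitch_of_unique {q : ℝ} (hq : 1 < q) (hq2 : q ≤ 2) {d : DigitSeq}
    (hd : ∀ e, value q e = value q d → e = d) :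
    AvoidsSwitch q fun n => value q (shift n d) := by
  have hq0 : 0 < q := by linarith
  have hq1 : 0 < q - 1 := by linarith
  constructor
  · intro n h
    have h1 := mul_value_shift hq d n
    have h2 := value_nonneg hq0 (shift (n + 1) d)
    rcases digit_cases (d n) with h3 | h3 <;> simp [h3] at h1 <;> linarith
  · intro n h
    have h1 := mul_value_shift hq d n
    have h2 := value_le hq (shift (n + 1) d)
    have h4 := tail_notMem_of_unique hq hq2 hd n (by rw [div_le_iff₀ hq0]; linarith)
    rw [div_lt_iff₀ (by positivity)] at h4
    refine ⟨by linarith, ?_⟩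
    rw [le_div_iff₀ hq1] at h2
    rcases digit_cases (d n) with h3 | h3 <;> simp [h3] at h1
    · nlinarith
    · linarith

section

variable {q : ℝ} {t : ℕ → ℝ}

theorem AvoidsSwitch.low_bounds (h : AvoidsSwitch q t) {a b l u : ℝ} (l' u' : ℝ) {n : ℕ}
    (hqa : a ≤ q) (hqb : q ≤ b) (ht : l ≤ t n ∧ t n ≤ u) (ha : 0 ≤ a) (hl : 0 ≤ l)
    (hu : b * u < 1) (hl' : l' ≤ a * l) (hu' : b * u ≤ u') :
    t (n + 1) = q * t n ∧ l' ≤ t (n + 1) ∧ t (n + 1) ≤ u' := by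
  have h1 : a * l ≤ q * t n := mul_le_mul hqa ht.1 hl (ha.trans hqa)
  have h2 : q * t n ≤ b * u := mul_le_mul hqb ht.2 (hl.trans ht.1) (by linarith)
  have h3 := h.low n (by linarith)
  exact ⟨h3, by linarith, by linarith⟩

theorem AvoidsSwitch.high_bounds (h : AvoidsSwitch q t) {a b l u : ℝ} (l' u' : ℝ) {n : ℕ}
    (hqa : a ≤ q) (hqb : q ≤ b) (ht : l ≤ t n ∧ t n ≤ u) (ha : 0 ≤ a) (hl : 0 ≤ l)
    (hu : 1 ≤ a * l) (hl' : l' ≤ a * l - 1) (hu' : b * u - 1 ≤ u') :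
    t (n + 1) = q * t n - 1 ∧ l' ≤ t (n + 1) ∧ t (n + 1) ≤ u' := by
  have h1 : a * l ≤ q * t n := mul_le_mul hqa ht.1 hl (ha.trans hqa)
  have h2 : q * t n ≤ b * u := mul_le_mul hqb ht.2 (hl.trans ht.1) (by linarith)
  have h3 := (h.high n (by linarith)).2
  exact ⟨h3, by linarith, by linarith⟩

/-- No orbit that starts in `(0, 1)` avoids the switch region if `q` is at most the golden ratio. -/
theorem AvoidsSwitch.golden_lt (h : AvoidsSwitch q t) (hq : 1 < q) (h0 : 0 < t 0) (h1 : t 0 < 1) :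
    1 < q * (q - 1) := by
  by_contra! hc
  -- If q(q-1) ≤ 1 the switch region extends to 1 or beyond, so the orbit in (0,1) can never
  -- subtract 1 and grows geometrically.
  have key : ∀ n, t n = q ^ n * t 0 ∧ q * t n < 1 := by
    have aux : ∀ n, 0 < t n → t n < 1 → q * t n < 1 := by
      intro n hn0 hn1
      by_contra! h2
      have h3 := (h.high n h2).1
      nlinarith
    intro n
    induction n with
    | zero => exact ⟨by simp, aux 0 h0 h1⟩
    | succ n ih =>
      have h2 := h.low n ih.2
      have h3 : t (n + 1) = q ^ (n + 1) * t 0 := by rw [h2, ih.1, pow_succ]; ring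
      exact ⟨h3, aux _ (by rw [h3]; positivity) (by rw [h2]; exact ih.2)⟩
  obtain ⟨n, hn⟩ := pow_unbounded_of_one_lt (1 / t 0) hq
  rw [div_lt_iff₀ h0] at hn
  have h2 := key n
  rw [← h2.1] at hn
  nlinarith [h2.2]

/-- Near the critical base, an orbit that lies slightly below the fixed point of the period
`0010001100011` and avoids the switch region follows that period. -/
theorem AvoidsSwitch.follows_period (h : AvoidsSwitch q t) (hq1 : 1.888452 ≤ q)
    (hq2 : q ≤ 1.8884533284) {p : ℝ} (hp1 : 0.167127 ≤ p) (hp2 : p ≤ 0.16713)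
    (hp : q ^ 13 * p - q ^ 10 - q ^ 6 - q ^ 5 - q - 1 = p) {n : ℕ} (hn1 : t n < p)
    (hn2 : p - 0.015 ≤ t n) :
    t (n + 13) < p ∧ p - 0.015 ≤ t (n + 13) ∧ p - t (n + 13) = q ^ 13 * (p - t n) := by
  have hq0 : 0 < q := lt_of_lt_of_le (by norm_num) hq1
  have b0 : (0.152127 : ℝ) ≤ t n ∧ t n ≤ 0.16713 :=
    ⟨le_trans (by norm_num at hp1 ⊢; linarith) hn2, hn1.le.trans hp2⟩
  obtain ⟨e1, b1⟩ := h.low_bounds (n := n + 0) 0.28728 0.3156175 hq1 hq2 b0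
    (by norm_num) (by norm_num) (by norm_num) (by norm_num) (by norm_num)
  obtain ⟨e2, b2⟩ := h.low_bounds (n := n + 1) 0.5425 0.59603 hq1 hq2 b1
    (by norm_num) (by norm_num) (by norm_num) (by norm_num) (by norm_num)
  have hq3 : q * (q - 1) ≤ 1.677803 := by
    refine (mul_le_mul hq2 (sub_le_sub_right hq2 1) ?_ (by norm_num)).trans (by norm_num)
    norm_num at hq1 ⊢; linarith
  -- The decisive use of avoidance: the interval for the third tail overlaps the switch region, so
  -- the tail must lie above its upper end 1/(q(q-1)). This fixes the orbit to within 3.5 · 10^-6 of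
  -- p.
  have b2' : 0.596017 ≤ t (n + 2) ∧ t (n + 2) ≤ 0.59603 := by
    refine ⟨?_, b2.2⟩
    have h1 : 1 ≤ q * t (n + 2) := by
      have := mul_le_mul hq1 b2.1 (by norm_num) hq0.le
      exact le_trans (by norm_num) this
    have h2 := (h.high (n + 2) h1).1
    have h3 := mul_le_mul_of_nonneg_right hq3
      (show (0 : ℝ) ≤ t (n + 2) from le_trans (by norm_num) b2.1)
    by_contra! hc
    norm_num at h2 h3 hc
    linarith
  obtain ⟨e3, b3⟩ := h.high_bounds (n := n + 2) 0.1255 0.12558 hq1 hq2 b2'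
    (by norm_num) (by norm_num) (by norm_num) (by norm_num) (by norm_num)
  obtain ⟨e4, b4⟩ := h.low_bounds (n := n + 3) 0.237 0.2372 hq1 hq2 b3
    (by norm_num) (by norm_num) (by norm_num) (by norm_num) (by norm_num)
  obtain ⟨e5, b5⟩ := h.low_bounds (n := n + 4) 0.4475 0.448 hq1 hq2 b4
    (by norm_num) (by norm_num) (by norm_num) (by norm_num) (by norm_num)
  obtain ⟨e6, b6⟩ := h.low_bounds (n := n + 5) 0.845 0.8461 hq1 hq2 b5
    (by norm_num) (by norm_num) (by norm_num) (by norm_num) (by norm_num)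
  obtain ⟨e7, b7⟩ := h.high_bounds (n := n + 6) 0.595 0.598 hq1 hq2 b6
    (by norm_num) (by norm_num) (by norm_num) (by norm_num) (by norm_num)
  obtain ⟨e8, b8⟩ := h.high_bounds (n := n + 7) 0.1236 0.1294 hq1 hq2 b7
    (by norm_num) (by norm_num) (by norm_num) (by norm_num) (by norm_num)
  obtain ⟨e9, b9⟩ := h.low_bounds (n := n + 8) 0.233 0.2445 hq1 hq2 b8
    (by norm_num) (by norm_num) (by norm_num) (by norm_num) (by norm_num)
  obtain ⟨e10, b10⟩ := h.low_bounds (n := n + 9) 0.44 0.4618 hq1 hq2 b9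
    (by norm_num) (by norm_num) (by norm_num) (by norm_num) (by norm_num)
  obtain ⟨e11, b11⟩ := h.low_bounds (n := n + 10) 0.83 0.8722 hq1 hq2 b10
    (by norm_num) (by norm_num) (by norm_num) (by norm_num) (by norm_num)
  obtain ⟨e12, b12⟩ := h.high_bounds (n := n + 11) 0.567 0.6472 hq1 hq2 b11
    (by norm_num) (by norm_num) (by norm_num) (by norm_num) (by norm_num)
  obtain ⟨e13, b13⟩ := h.high_bounds (n := n + 12) 0.07 0.23 hq1 hq2 b12
    (by norm_num) (by norm_num) (by norm_num) (by norm_num) (by norm_num)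
  have e : p - t (n + 13) = q ^ 13 * (p - t n) := by
    simp only [add_zero] at e1
    linear_combination -hp - e13 - q * e12 - q ^ 2 * e11 - q ^ 3 * e10 - q ^ 4 * e9 - q ^ 5 * e8
      - q ^ 6 * e7 - q ^ 7 * e6 - q ^ 8 * e5 - q ^ 9 * e4 - q ^ 10 * e3 - q ^ 11 * e2 - q ^ 12 * e1
  have hz : 0 < p - t n := by linarith
  have hz' : p - t n ≤ 0.0000035 := by
    have h1 : q * q ≤ 3.566256 :=
      (mul_le_mul hq2 hq2 hq0.le (by norm_num)).trans (by norm_num)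
    have h2 : t (n + 2) = q * q * t n := by rw [e2, e1, mul_assoc]; rfl
    have h3 := mul_le_mul_of_nonneg_right h1 (le_trans (by norm_num) b0.1)
    have h4 := b2'.1
    norm_num at h3 h4 hp2 ⊢
    linarith
  -- Since 3886 · 0.0000035 < 0.015, the expanded distance still meets the starting condition for
  -- the next period.
  have h13 : q ^ 13 ≤ 3886 := (pow_le_pow_left₀ hq0.le hq2 13).trans (by norm_num)
  have h5 : q ^ 13 * (p - t n) ≤ 3886 * 0.0000035 := mul_le_mul h13 hz' hz.le (by norm_num)
  have h6 : 0 < q ^ 13 * (p - t n) := by positivity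
  refine ⟨by linarith, ?_, e⟩
  norm_num at h5 ⊢
  linarith

theorem AvoidsSwitch.false_of_near_period (h : AvoidsSwitch q t) (hq1 : 1.888452 ≤ q)
    (hq2 : q ≤ 1.8884533284) {p : ℝ} (hp1 : 0.167127 ≤ p) (hp2 : p ≤ 0.16713)
    (hp : q ^ 13 * p - q ^ 10 - q ^ 6 - q ^ 5 - q - 1 = p) {n : ℕ} (hn1 : t n < p)
    (hn2 : p - 0.015 ≤ t n) : False := by
  have key : ∀ k, t (n + 13 * k) < p ∧ p - 0.015 ≤ t (n + 13 * k) ∧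
      p - t (n + 13 * k) = (q ^ 13) ^ k * (p - t n) := by
    intro k
    induction k with
    | zero => exact ⟨hn1, hn2, by simp⟩
    | succ k ih =>
      obtain ⟨h1, h2, h3⟩ := h.follows_period hq1 hq2 hp1 hp2 hp ih.1 ih.2.1
      refine ⟨h1, h2, h3.trans ?_⟩
      rw [ih.2.2, pow_succ]; ring
  have hq : 1 < q ^ 13 := one_lt_pow₀ (lt_of_lt_of_le (by norm_num) hq1) (by norm_num)
  obtain ⟨k, hk⟩ := pow_unbounded_of_one_lt (0.015 / (p - t n)) hq
  rw [div_lt_iff₀ (by linarith)] at hk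
  have := key k
  linarith

end

/-- No base below the critical one gives `1 / g` a unique expansion. -/
theorem notMem_univoqueBases_of_lt {r q : ℝ} (hr2 : r < 1.8884533284)
    (hrv : value r critSeq = 1 / Real.goldenRatio) (hqr : q < r) :
    q ∉ univoqueBases (1 / Real.goldenRatio) := by
  rintro ⟨⟨hq, hq2⟩, d, hd, hu⟩
  have hd : value q d = 1 / Real.goldenRatio := hd
  have h := avoidsSwitch_of_unique hq hq2 (d := d) fun e he => hu e (Eq.trans he hd)
  have ht0 : value q (shift 0 d) = 1 / Real.goldenRatio := by rw [shift_zero, hd]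
  set t := fun n => value q (shift n d)
  have ht0 : t 0 = 1 / Real.goldenRatio := ht0
  obtain ⟨hx1, hx2⟩ := inv_goldenRatio_bounds
  have hsq := inv_goldenRatio_sq
  set x := 1 / Real.goldenRatio
  norm_num at hx1 hx2
  have hgold := h.golden_lt hq (by rw [ht0]; linarith) (by rw [ht0]; linarith)
  have hqx : 1 ≤ q * t 0 := by
    rw [ht0]; nlinarith
  obtain ⟨g0, e1⟩ := h.high 0 hqx
  rw [ht0] at g0 e1
  norm_num at hr2
  have hqu : q < 1.8885 := by norm_num; linarith
  norm_num at hqu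
  -- From `g0`: q(q-1) > 1/g = q_G.
  have hql : 1.866 < q := by norm_num; nlinarith
  norm_num at hql
  have u1 : t 1 < 0.168 := by rw [e1]; norm_num; nlinarith
  norm_num at u1
  have p1 : 0 < t 1 := by rw [e1]; nlinarith
  have e2 := h.low 1 (by nlinarith)
  have u2 : t 2 < 0.318 := by rw [e2]; norm_num; nlinarith
  norm_num at u2
  have p2 : 0 < t 2 := by rw [e2]; positivity
  have e3 := h.low 2 (by nlinarith)
  -- Here g^2 + g = 1 matters: the factor q(q-1)g - 1 splits off, and it is positive by avoidance at
  -- time 0.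
  have e3' : q * t 3 - 1 = (q * (q - 1) * x - 1) * (q ^ 2 - x * q + 1) := by
    rw [e3, e2, e1]; linear_combination (q ^ 3 - q ^ 2) * hsq
  have h3 : 1 ≤ q * t 3 := by
    have : 0 < (q * (q - 1) * x - 1) * (q ^ 2 - x * q + 1) := by
      apply mul_pos <;> nlinarith
    linarith
  obtain ⟨g3, -⟩ := h.high 3 h3
  -- q(q-1) t_3 = q^3(q-1)(qg-1) increases with q and is still below 1 at 1.888452, contradicting
  -- avoidance at time 3.
  have hqa : 1.888452 ≤ q := by
    by_contra! hc
    have h1 : q * (q - 1) * t 3 = q ^ 3 * (q - 1) * (q * x - 1) := by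
      rw [e3, e2, e1]; ring
    have h2 : q ^ 3 * (q - 1) * (q * x - 1) ≤
        1.888452 ^ 3 * (1.888452 - 1) * (1.888452 * 0.61803398875 - 1) := by
      have a1 : q * x ≤ 1.888452 * 0.61803398875 :=
        mul_le_mul hc.le (by norm_num; linarith) (by linarith) (by norm_num)
      have a2 : 0 ≤ q * x - 1 := by linarith
      have a3 : 0 ≤ q - 1 := by linarith
      gcongr
    rw [← h1] at h2
    norm_num at h2
    linarith
  have hqb : q ≤ 1.8884533284 := by norm_num; linarith
  have hs : ∀ {y : ℝ}, 1 < y → y * value y critSeq = 1 + value y (shift 1 critSeq) := by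
    intro y hy
    simpa [critSeq_zero] using mul_value hy critSeq
  have hlt : x < value q critSeq := hrv ▸ value_strictAnti hq hqr critSeq_zero
  have hc := value_mem_of_cert (Q := 18884520000) (u := [1]) (v := periodWord)
    (lo := 0) (up := 618034680000000) (by decide +kernel)
  have hc' : value q critSeq ≤ 0.61803468 := by
    refine le_trans ((value_antitone ?_ ?_ critSeq).trans hc.2) ?_
    · norm_num
    · norm_num at hqa ⊢; linarith
    · norm_num
  have hpoly := value_critSeq_poly hq
  have hp := hs hq
  have hqx' := mul_le_mul hqa (show (0.61803398874 : ℝ) ≤ x by norm_num; linarith) (by norm_num)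
    (by linarith)
  have hqv := mul_le_mul hqb hc' (by linarith) (by norm_num)
  have hqlt := mul_lt_mul_of_pos_left hlt (by linarith : 0 < q)
  -- The fixed point is p = q · (critical sequence)_q - 1, while t_1 = qg - 1; it lies below p
  -- because q < r makes the critical value exceed g.
  refine h.false_of_near_period hqa hqb (p := value q (shift 1 critSeq)) (n := 1) ?_ ?_ ?_ ?_ ?_
  · norm_num at hqx' ⊢; linarith
  · norm_num at hqv ⊢; linarith
  · linear_combination -q * hpoly - (q ^ 13 - 1) * hp
  · rw [e1]; linarith
  · rw [e1]; norm_num at hqv hqx' ⊢; linarith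

/-! ### Assembling the theorem -/

theorem bddBelow_univoqueBases (x : ℝ) : BddBelow (univoqueBases x) :=
  ⟨1, fun _ hq => hq.1.1.le⟩

theorem exists_base_lt {r x : ℝ} (hr1 : 1.8884533277 < r) (hr2 : r < 1.8884533284)
    (hrv : value r critSeq = 1 / Real.goldenRatio) (hx : 0 < x) (hne : x ≠ 1 / Real.goldenRatio) :
    ∃ q ∈ univoqueBases x, q < r := by
  rcases lt_or_gt_of_ne hne with h | h
  · exact exists_base_lt_of_small hr1 hr2 hx h
  · exact exists_base_lt_of_gt hr1 (by norm_num at hr2; linarith) (hrv ▸ h)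

theorem value_critSeq_eq_iff {r q : ℝ} (hr : 1 < r) (hq : 1 < q) :
    value q critSeq = value r critSeq ↔ q = r := by
  refine ⟨fun h => ?_, fun h => h ▸ rfl⟩
  rcases lt_trichotomy q r with hlt | heq | hlt
  · exact absurd h (value_strictAnti hq hlt critSeq_zero).ne'
  · exact heq
  · exact absurd h (value_strictAnti hr hlt critSeq_zero).ne

end SmallestUnivoqueBase

theorem theorem7p1 :
    -- `q_s` is an infimum over a non-empty set of bases
    (∀ x : ℝ, 0 < x → (SmallestUnivoqueBase.univoqueBases x).Nonempty) ∧
    1 / Real.goldenRatio = (Real.sqrt 5 - 1) / 2 ∧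
    ∃ r : ℝ,
      -- `r` is the unique base with `(1(0010001100011)^∞)_r = (100(1000110001100)^∞)_r = 1/q_G`
      r ∈ Set.Ioc (1 : ℝ) 2 ∧
      (∀ q ∈ Set.Ioc (1 : ℝ) 2,
        SmallestUnivoqueBase.value q (SmallestUnivoqueBase.eventuallyPeriodic
          [1] [0, 0, 1, 0, 0, 0, 1, 1, 0, 0, 0, 1, 1]) = 1 / Real.goldenRatio ↔ q = r) ∧
      (∀ q ∈ Set.Ioc (1 : ℝ) 2,
        SmallestUnivoqueBase.value q (SmallestUnivoqueBase.eventuallyPeriodic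
          [1, 0, 0] [1, 0, 0, 0, 1, 1, 0, 0, 0, 1, 1, 0, 0]) = 1 / Real.goldenRatio ↔ q = r) ∧
      -- numerical value, correct to the nine decimals given
      |r - 1.888453328| < 5 / 10 ^ 10 ∧
      -- `r` is the maximum value of `q_s`, attained at `1/q_G` and nowhere else
      IsGreatest (SmallestUnivoqueBase.qs '' Set.Ioi 0) r ∧
      SmallestUnivoqueBase.qs (1 / Real.goldenRatio) = r ∧
      (∀ x : ℝ, 0 < x → x ≠ 1 / Real.goldenRatio → SmallestUnivoqueBase.qs x < r) ∧
      -- `r` is an algebraic integer of degree `26` with the given irreducible polynomial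
      IsIntegral ℤ r ∧
      (minpoly ℚ r).natDegree = 26 ∧
      Irreducible SmallestUnivoqueBase.maxPoly ∧
      Polynomial.aeval r SmallestUnivoqueBase.maxPoly = 0 ∧
      minpoly ℚ r = SmallestUnivoqueBase.maxPoly.map (Int.castRingHom ℚ) := by
  obtain ⟨r, hr1, hr2, hrv⟩ := SmallestUnivoqueBase.exists_critical_base
  have hr1' := hr1
  have hr2' := hr2
  norm_num at hr1' hr2'
  have hr0 : 1 < r := by linarith
  have hlt := fun x hx hne =>
    SmallestUnivoqueBase.exists_base_lt (x := x) hr1 hr2 hrv hx hne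
  have hmem : r ∈ SmallestUnivoqueBase.univoqueBases (1 / Real.goldenRatio) :=
    (SmallestUnivoqueBase.univoqueIn_critSeq (by norm_num; linarith)).mem_univoqueBases hr0
      (by linarith) hrv
  have hqs : SmallestUnivoqueBase.qs (1 / Real.goldenRatio) = r := by
    refine IsLeast.csInf_eq ⟨hmem, fun q hq => ?_⟩
    by_contra! h
    exact SmallestUnivoqueBase.notMem_univoqueBases_of_lt hr2 hrv h hq
  have hqslt : ∀ x : ℝ, 0 < x → x ≠ 1 / Real.goldenRatio → SmallestUnivoqueBase.qs x < r := by
    intro x hx hne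
    obtain ⟨q, hq, hqr⟩ := hlt x hx hne
    exact (csInf_le (SmallestUnivoqueBase.bddBelow_univoqueBases x) hq).trans_lt hqr
  have hroot := SmallestUnivoqueBase.aeval_maxPoly_eq_zero
    SmallestUnivoqueBase.inv_goldenRatio_sq
    (hrv ▸ SmallestUnivoqueBase.value_critSeq_poly hr0)
  obtain ⟨hint, hmin⟩ := SmallestUnivoqueBase.minpoly_eq_of_root hroot
  have hiff : ∀ q ∈ Set.Ioc (1 : ℝ) 2, SmallestUnivoqueBase.value q
      SmallestUnivoqueBase.critSeq = 1 / Real.goldenRatio ↔ q = r := fun q hq => by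
    rw [← hrv]
    exact SmallestUnivoqueBase.value_critSeq_eq_iff hr0 hq.1
  refine ⟨fun x hx => ?_, SmallestUnivoqueBase.inv_goldenRatio, r, ⟨hr0, by linarith⟩, hiff, ?_,
    ?_, ⟨⟨_, by simp only [Set.mem_Ioi]; positivity, hqs⟩, ?_⟩, hqs, hqslt, hint, ?_,
    SmallestUnivoqueBase.irreducible_maxPoly, hroot, hmin⟩
  · by_cases h : x = 1 / Real.goldenRatio
    · exact ⟨r, h ▸ hmem⟩
    · obtain ⟨q, hq, -⟩ := hlt x hx h
      exact ⟨q, hq⟩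
  · rw [SmallestUnivoqueBase.critSeq_eq]
    exact hiff
  · rw [abs_lt]
    constructor <;> norm_num <;> linarith
  · rintro _ ⟨x, hx, rfl⟩
    by_cases h : x = 1 / Real.goldenRatio
    · exact (h ▸ hqs).le
    · exact (hqslt x hx h).le
  · rw [hmin, SmallestUnivoqueBase.monic_maxPoly.natDegree_map,
      SmallestUnivoqueBase.natDegree_maxPoly]
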